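/- There is an absolute constant $C>0$ such that the following holds. Let $0<\beta\le 1$, $b>0$, $A\ge 1$. For $i=1,2,3$ let $U_i\subseteq\mathbb{R}^2$ be open and convex (possibly unbounded), let $F_i\in C^{1,\beta}(U_i)$ (it suffices that $\nabla F_i$ is locally $\beta$-Hölder; no uniform bound is required), let $G_i\in O(3)$, and let $$S_i=G_i\{(x,y,z)\in\mathbb{R}^3 : (x,y)\in U_i,\ z=F_i(x,y)\},$$ with surface measure $\sigma_i$ and the continuous unit normal field $\mathfrak{n}_i$ given at $G_i(x,y,F_i(x,y))$ by $G_i(-\nabla F_i(x,y),1)/\sqrt{1+|\nabla F_i(x,y)|^2}$. (The opposite orientation of the same surface arises from $-F_i$ and $G_i\,\mathrm{diag}(1,1,-1)$.) Assume that for $i=1,2,3$ $$\sup_{\sigma\ne\tilde\sigma\in S_i}\left(\frac{|\mathfrak{n}_i(\sigma)-\mathfrak{n}_i(\tilde\sigma)|}{|\sigma-\tilde\sigma|^{\beta}}+\frac{|\mathfrak{n}_i(\sigma)\cdot(\sigma-\tilde\sigma)|}{|\sigma-\tilde\sigma|^{1+\beta}}\right)\le b,$$ and that $$A^{-1}\le\det\big(\mathfrak{n}_1(s_1),\mathfrak{n}_2(s_2),\mathfrak{n}_3(s_3)\big)\le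 1\qquad\text{for all }(s_1,s_2,s_3)\in S_1\times S_2\times S_3 .$$ For complex-valued functions $f$ on $S_1$ and $g$ on $S_2$ let $f*g$ be the density of the convolution of the measures $f\,d\sigma_1$ and $g\,d\sigma_2$, defined pointwise by $$(f*g)(x)=\int_{S_1\cap(x-S_2)}\frac{f(y)\,g(x-y)}{\sin\alpha(y,x-y)}\,d\mathcal{H}^1(y),$$ where $\alpha(y,z)$ is the angle between $\mathfrak{n}_1(y)$ and $\mathfrak{n}_2(z)$ and $\mathcal{H}^1$ is one-dimensional Hausdorff measure. Then for all $f\in L^2(S_1,\sigma_1)$ and $g\in L^2(S_2,\sigma_2)$ this integral converges absolutely for $\sigma_3$-almost every $x\in S_3$, the function $f*g$ belongs to $L^2(S_3,\sigma_3)$, and $$\|f*g\|_{L^2(S_3)}\le C A^{1/2}\,\|f\|_{L^2(S_1)}\,\|g\|_{L^2(S_2)} .$$ In particular $C$ does not depend on $\beta$, $b$, $A$ or the surfaces. -/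

import Mathlib

open MeasureTheory
open scoped ENNReal

/-- The data of a rotated graph in `ℝ³`: a set `U ⊆ ℝ²`, a function `F` on `U`
(its values off `U` play no role) and an orthogonal transformation `G ∈ O(3)`. -/
structure RotatedGraph where
  U : Set (EuclideanSpace ℝ (Fin 2))
  F : EuclideanSpace ℝ (Fin 2) → ℝ
  G : EuclideanSpace ℝ (Fin 3) ≃ₗᵢ[ℝ] EuclideanSpace ℝ (Fin 3)

namespace RotatedGraph

/-- The parametrization `(x, y) ↦ G (x, y, F (x, y))`. -/
noncomputable def param (S : RotatedGraph) (p : EuclideanSpace ℝ (Fin 2)) :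
    EuclideanSpace ℝ (Fin 3) :=
  S.G !₂[p 0, p 1, S.F p]

/-- The surface itself, `G gr(F)`, as a subset of `ℝ³`. -/
def carrier (S : RotatedGraph) : Set (EuclideanSpace ℝ (Fin 3)) :=
  S.param '' S.U

/-- The parameter `(x, y)` of the point `G (x, y, z)`; a left inverse of `param`. -/
noncomputable def base (S : RotatedGraph) (σ : EuclideanSpace ℝ (Fin 3)) :
    EuclideanSpace ℝ (Fin 2) :=
  !₂[S.G.symm σ 0, S.G.symm σ 1]

/-- The unit normal `G (-∂₁F, -∂₂F, 1) / √(1 + |∇F|²)` at a point of the surface. The opposite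
orientation of the same surface is covered as well: it is the one which belongs to `-F` and
`G ∘ diag(1, 1, -1)`. -/
noncomputable def normal (S : RotatedGraph) (σ : EuclideanSpace ℝ (Fin 3)) :
    EuclideanSpace ℝ (Fin 3) :=
  S.G ((Real.sqrt (1 + ‖gradient S.F (S.base σ)‖ ^ 2))⁻¹ •
    !₂[-(gradient S.F (S.base σ) 0), -(gradient S.F (S.base σ) 1), 1])

/-- The surface measure: the image of `√(1 + |∇F|²) dx dy` on `U` under the parametrization. -/
noncomputable def surfaceMeasure (S : RotatedGraph) : Measure (EuclideanSpace ℝ (Fin 3)) :=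
  ((volume.restrict S.U).withDensity
    (fun p => ENNReal.ofReal (Real.sqrt (1 + ‖gradient S.F p‖ ^ 2)))).map S.param

end RotatedGraph

/-- `F` is of class `C^{1,β}` on the open set `U`: it is continuously differentiable and its
gradient is `β`-Hölder continuous on compact subsets of `U`. No bound that is uniform
on `U` is required. -/
def IsC1Holder (β : ℝ) (F : EuclideanSpace ℝ (Fin 2) → ℝ)
    (U : Set (EuclideanSpace ℝ (Fin 2))) : Prop :=
  ContDiffOn ℝ 1 F U ∧
    ∀ K ⊆ U, IsCompact K → ∃ L : ℝ, ∀ p ∈ K, ∀ q ∈ K,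
      ‖gradient F p - gradient F q‖ ≤ L * ‖p - q‖ ^ β

/-- The assumptions on the three surfaces, with parameters `β`, `b` and `A`. -/
structure TransverseSurfaces (S : Fin 3 → RotatedGraph) (β b A : ℝ) : Prop where
  beta_pos : 0 < β
  beta_le_one : β ≤ 1
  b_pos : 0 < b
  one_le_A : 1 ≤ A
  isOpen : ∀ i, IsOpen (S i).U
  convex : ∀ i, Convex ℝ (S i).U
  regular : ∀ i, IsC1Holder β (S i).F (S i).U
  /-- The Hölder condition on the unit normals; for `σ = τ` both quotients are `0 / 0 = 0`. -/
  holder_normal : ∀ i, ∀ σ ∈ (S i).carrier, ∀ τ ∈ (S i).carrier,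
    ‖(S i).normal σ - (S i).normal τ‖ / ‖σ - τ‖ ^ β +
      |inner ℝ ((S i).normal σ) (σ - τ)| / ‖σ - τ‖ ^ (1 + β) ≤ b
  /-- Transversality: the matrix has the columns `n₁(σ₁)`, `n₂(σ₂)`, `n₃(σ₃)`. -/
  transversal : ∀ σ : Fin 3 → EuclideanSpace ℝ (Fin 3), (∀ i, σ i ∈ (S i).carrier) →
    A⁻¹ ≤ (Matrix.of fun r c : Fin 3 => (S c).normal (σ c) r).det ∧
      (Matrix.of fun r c : Fin 3 => (S c).normal (σ c) r).det ≤ 1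

/-- The curve `S₁ ∩ (x - S₂)`. -/
def convCurve (S₁ S₂ : RotatedGraph) (x : EuclideanSpace ℝ (Fin 3)) :
    Set (EuclideanSpace ℝ (Fin 3)) :=
  {y | y ∈ S₁.carrier ∧ x - y ∈ S₂.carrier}

/-- The integrand `f(y) g(x - y) / sin α(y, x - y)` of the convolution, with `α(y, z)` the angle
between the normals `n₁(y)` and `n₂(z)`. -/
noncomputable def convIntegrand (S₁ S₂ : RotatedGraph) (f g : EuclideanSpace ℝ (Fin 3) → ℂ)
    (x y : EuclideanSpace ℝ (Fin 3)) : ℂ :=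
  f y * g (x - y) /
    ((Real.sin (InnerProductGeometry.angle (S₁.normal y) (S₂.normal (x - y))) : ℝ) : ℂ)

/-- The convolution `f * g` of a function `f` on `S₁` and a function `g` on `S₂` as a function of
`x ∈ ℝ³`: the density, given at each point `x` by integration over the curve `S₁ ∩ (x - S₂)`
with respect to length (one-dimensional Hausdorff measure), of the convolution of the measures
`f dσ₁` and `g dσ₂`. -/
noncomputable def surfaceConv (S₁ S₂ : RotatedGraph) (f g : EuclideanSpace ℝ (Fin 3) → ℂ)
    (x : EuclideanSpace ℝ (Fin 3)) : ℂ :=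
  ∫ y in convCurve S₁ S₂ x, convIntegrand S₁ S₂ f g x y ∂(Measure.hausdorffMeasure 1)

/-!
The proof rests on the Cauchy–Schwarz inequality and one change of variables; the constant is `1`.

For `x ∈ S₃`, write `γ = S₁ ∩ (x - S₂)`. By the Cauchy–Schwarz inequality, `|(f * g)(x)|²` is at
most the product of the integrals of `|f(y)|² / sin α` and of `|g(x - y')|² / sin α` over `y ∈ γ`
and `y' ∈ γ`. Integrated over `x ∈ S₃`, this product becomes an integral over the triples
`(x, y, y')` of `|f(y)|² |g(x - y')|²`, an expression which depends only on the pair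
`(y, x - y') ∈ S₁ × S₂`. Both the space of triples and `S₁ × S₂` have dimension four.

The map `(x, y, y') ↦ (y, x - y')` is injective: if two triples with first entries `x ≠ u` have the
same image, then `x - u` is a chord of each of the three surfaces. By the mean value theorem
(`exists_inner_normal_sub_eq_zero`, the place where convexity of the domains enters), each surface
then has a normal orthogonal to `x - u`, and the determinant of these normals vanishes. With respect
to the measures `dσ₃(x) dℋ¹(y) dℋ¹(y') / (sin α sin α')` and `dσ₁ dσ₂` the map has the Jacobian
`det (n₁(y'), n₂(x - y), n₃(x)) ≥ A⁻¹` (`hasFDerivAt_crossMap`). This gives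
`‖f * g‖² ≤ A ‖f‖² ‖g‖²`, see `lintegral_heightIntegral_mul_le`.

To carry this out, fix a normal `N` of `S₃`. The same chord argument shows that the map
`(σ₁, σ₂) ↦ (σ₁ + σ₂, ⟨N, σ₁⟩)` on `S₁ × S₂` (`sumHeight`) is injective, and the inverse function
theorem makes its range open and its inverse (`split`) differentiable. Hence the height `⟨N, y⟩` is
a global parameter on every curve `S₁ ∩ (x - S₂)`, jointly measurable in `x`. The curve has the
speed `sin α / det (n₁, n₂, N)`, and the area formula for curves (`hausdorffMeasure_image_curve`)
turns the integrals with respect to `ℋ¹` into integrals over the height. That the values of `f` and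
`g` on null sets do not matter follows from the same estimate, applied to indicator functions of
null sets (`ae_ae_notMem`).
-/

/-! ### Length of a parametrized curve -/

section CurveLength

open Set

variable {E : Type*} [NormedAddCommGroup E] [NormedSpace ℝ E]
  [MeasurableSpace E] [BorelSpace E]

/-- A differentiable curve is, on countably many measurable pieces of its parameter set, close to
an affine map, whose velocity is also close to the derivative of the curve. -/
lemma exists_partition_curve [SecondCountableTopology E] (c c' : ℝ → E) (s : Set ℝ)
    (hs : MeasurableSet s)
    (hc : ∀ t ∈ s, HasDerivWithinAt c (c' t) s t) (hm : Measurable c') {ε : NNReal} (hε : 0 < ε) :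
    ∃ (u : ℕ → Set ℝ) (v : ℕ → E), Pairwise (Function.onFun Disjoint u) ∧
      (∀ n, MeasurableSet (u n)) ∧ (⋃ n, u n) = s ∧
      (∀ n, ∀ x ∈ u n, ∀ y ∈ u n, ‖c x - c y - (x - y) • v n‖ ≤ ε * ‖x - y‖) ∧
      ∀ n, ∀ x ∈ u n, ‖c' x - v n‖ ≤ ε := by
  obtain ⟨d, hd⟩ := TopologicalSpace.exists_dense_seq E
  -- first split according to the value of the derivative
  let w : ℕ → Set ℝ := fun k => s ∩ c' ⁻¹' (Metric.ball (d k) (ε / 2))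
  have hw : ∀ k, MeasurableSet (w k) := fun k => hs.inter (hm Metric.isOpen_ball.measurableSet)
  have hws : (⋃ k, w k) = s := by
    ext t
    simp only [w, mem_iUnion, mem_inter_iff, mem_preimage]
    refine ⟨fun ⟨k, h⟩ => h.1, fun h => ?_⟩
    obtain ⟨k, hk⟩ := hd.exists_dist_lt (c' t) (show (0 : ℝ) < ε / 2 by positivity)
    exact ⟨k, h, by simpa [Metric.mem_ball] using hk⟩
  have key : ∀ k, ∃ (t : ℕ → Set ℝ) (A : ℕ → ℝ →L[ℝ] E),
      Pairwise (Function.onFun Disjoint t) ∧ (∀ n, MeasurableSet (t n)) ∧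
      (disjointed w k ⊆ ⋃ n, t n) ∧
      (∀ n, ApproximatesLinearOn c (A n) (disjointed w k ∩ t n) ε) ∧
      ((disjointed w k).Nonempty → ∀ n, ∃ y ∈ disjointed w k,
        A n = ContinuousLinearMap.toSpanSingleton ℝ (c' y)) := fun k =>
    exists_partition_approximatesLinearOn_of_hasFDerivWithinAt c (disjointed w k)
      (fun y => ContinuousLinearMap.toSpanSingleton ℝ (c' y))
      (fun x hx => ((hc x (disjointed_subset w k hx).1).mono
        ((disjointed_subset w k).trans inter_subset_left)).hasFDerivWithinAt)
      (fun _ => ε) (fun _ => hε.ne')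
  choose t A h1 h2 h3 h4 h5 using key
  let e := Nat.pairEquiv.symm
  refine ⟨fun n => disjointed w (e n).1 ∩ t (e n).1 (e n).2, fun n => A (e n).1 (e n).2 1,
    ?_, ?_, ?_, ?_, ?_⟩
  · intro m n hmn
    by_cases h : (e m).1 = (e n).1
    · have h' : (e m).2 ≠ (e n).2 := fun h' => hmn (e.injective (Prod.ext h h'))
      have := h1 (e n).1 h'
      simp only [Function.onFun] at this ⊢
      rw [h]
      exact this.mono inter_subset_right inter_subset_right
    · exact (disjoint_disjointed w h).mono inter_subset_left inter_subset_left
  · exact fun n => (MeasurableSet.disjointed hw _).inter (h2 _ _)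
  · rw [← hws, ← iUnion_disjointed (f := w)]
    apply Subset.antisymm
    · exact iUnion_subset fun n => inter_subset_left.trans (subset_iUnion _ _)
    · refine iUnion_subset fun k x hx => ?_
      obtain ⟨n, hn⟩ := mem_iUnion.1 (h3 k hx)
      refine mem_iUnion.2 ⟨e.symm (k, n), ?_⟩
      simpa using ⟨hx, hn⟩
  · intro n x hx y hy
    have := h4 _ _ x hx y hy
    rwa [show A (e n).1 (e n).2 (x - y) = (x - y) • A (e n).1 (e n).2 1 by
      rw [← map_smul]; simp] at this
  · intro n x hx
    obtain ⟨y, hy, hA⟩ := h5 (e n).1 ⟨x, hx.1⟩ (e n).2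
    change ‖c' x - A (e n).1 (e n).2 1‖ ≤ ε
    rw [hA]
    have hx' := (disjointed_subset w _ hx.1).2
    have hy' := (disjointed_subset w _ hy).2
    simp only [mem_preimage, Metric.mem_ball] at hx' hy'
    have := dist_triangle_right (c' x) (c' y) (d (e n).1)
    rw [dist_eq_norm] at this
    simp only [ContinuousLinearMap.toSpanSingleton_apply, one_smul]
    linarith

lemma hausdorffMeasure_image_le_of_approx {c : ℝ → E} {u : Set ℝ} {v : E} {ε : NNReal}
    (h : ∀ x ∈ u, ∀ y ∈ u, ‖c x - c y - (x - y) • v‖ ≤ ε * ‖x - y‖) :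
    Measure.hausdorffMeasure 1 (c '' u) ≤ (‖v‖ₑ + ε) * volume u := by
  have : LipschitzOnWith (‖v‖₊ + ε) c u := by
    refine LipschitzOnWith.of_dist_le_mul fun x hx y hy => ?_
    rw [dist_eq_norm, dist_eq_norm]
    calc ‖c x - c y‖ = ‖(c x - c y - (x - y) • v) + (x - y) • v‖ := by congr 1; abel
      _ ≤ ε * ‖x - y‖ + ‖x - y‖ * ‖v‖ := (norm_add_le _ _).trans
          (add_le_add (h x hx y hy) (norm_smul _ _).le)
      _ = _ := by push_cast; ring
  have := this.hausdorffMeasure_image_le (d := 1) zero_le_one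
  simpa [hausdorffMeasure_real, enorm_eq_nnnorm] using this

lemma le_hausdorffMeasure_image_of_approx {c : ℝ → E} {u : Set ℝ} {v : E} {ε : NNReal}
    (h : ∀ x ∈ u, ∀ y ∈ u, ‖c x - c y - (x - y) • v‖ ≤ ε * ‖x - y‖) :
    ‖v‖ₑ * volume u ≤ Measure.hausdorffMeasure 1 (c '' u) + ε * volume u := by
  -- for `ε < ‖v‖` the curve is injective on `u`, with a Lipschitz inverse
  rcases le_or_gt ‖v‖₊ ε with hv | hv
  · refine le_add_left ?_
    gcongr
    exact_mod_cast hv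
  have hlow : ∀ x ∈ u, ∀ y ∈ u, (‖v‖ - ε) * ‖x - y‖ ≤ ‖c x - c y‖ := by
    intro x hx y hy
    have h1 := h x hx y hy
    have h2 := norm_sub_norm_le ((x - y) • v) ((x - y) • v - (c x - c y))
    rw [sub_sub_cancel, norm_sub_rev _ (c x - c y), norm_smul] at h2
    linarith
  have hpos : 0 < ‖v‖₊ - ε := tsub_pos_of_lt hv
  have hcoe : ((‖v‖₊ - ε : NNReal) : ℝ) = ‖v‖ - ε := by
    rw [NNReal.coe_sub hv.le]; rfl
  have hinj : InjOn c u := by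
    intro x hx y hy hxy
    have := hlow x hx y hy
    rw [hxy, sub_self, norm_zero, ← hcoe] at this
    have h0 : ‖x - y‖ ≤ 0 := nonpos_of_mul_nonpos_right this (by exact_mod_cast hpos)
    exact sub_eq_zero.1 (norm_le_zero_iff.1 h0)
  have hlip : LipschitzOnWith (‖v‖₊ - ε)⁻¹ (Function.invFunOn c u) (c '' u) := by
    refine LipschitzOnWith.of_dist_le_mul ?_
    rintro _ ⟨x, hx, rfl⟩ _ ⟨y, hy, rfl⟩
    rw [hinj.leftInvOn_invFunOn hx, hinj.leftInvOn_invFunOn hy, dist_eq_norm, dist_eq_norm,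
      NNReal.coe_inv, hcoe, ← div_eq_inv_mul, le_div_iff₀ (hcoe ▸ (by exact_mod_cast hpos)),
      mul_comm]
    exact hlow x hx y hy
  have := hlip.hausdorffMeasure_image_le (d := 1) zero_le_one
  rw [hinj.invFunOn_image Subset.rfl, hausdorffMeasure_real, ENNReal.rpow_one,
    ENNReal.coe_inv hpos.ne', mul_comm, ← div_eq_mul_inv,
    ENNReal.le_div_iff_mul_le (.inl (by exact_mod_cast hpos.ne')) (.inl ENNReal.coe_ne_top)] at this
  calc ‖v‖ₑ * volume u = ((‖v‖₊ - ε + ε : NNReal) : ℝ≥0∞) * volume u := by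
        rw [tsub_add_cancel_of_le hv.le]; rfl
    _ ≤ _ := by rw [ENNReal.coe_add, add_mul, mul_comm]; gcongr

lemma hausdorffMeasure_image_curve_aux [SecondCountableTopology E] {c c' : ℝ → E} {s : Set ℝ}
    (hs : MeasurableSet s)
    (hc : ∀ t ∈ s, HasDerivWithinAt c (c' t) s t) (hm : Measurable c') (hinj : InjOn c s)
    (hfin : volume s ≠ ∞) :
    Measure.hausdorffMeasure 1 (c '' s) = ∫⁻ t in s, ‖c' t‖ₑ := by
  have key : ∀ ε : NNReal, 0 < ε →
      Measure.hausdorffMeasure 1 (c '' s) ≤ (∫⁻ t in s, ‖c' t‖ₑ) + 2 * ε * volume s ∧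
      (∫⁻ t in s, ‖c' t‖ₑ) ≤ Measure.hausdorffMeasure 1 (c '' s) + 2 * ε * volume s := by
    intro ε hε
    obtain ⟨u, v, hd, hu, hus, h1, h2⟩ := exists_partition_curve c c' s hs hc hm hε
    have hle : ∀ n, ∀ x ∈ u n, ‖v n‖ₑ ≤ ‖c' x‖ₑ + ε ∧ ‖c' x‖ₑ ≤ ‖v n‖ₑ + ε := by
      intro n x hx
      have h := h2 n x hx
      have a1 := norm_le_norm_add_norm_sub' (c' x) (v n)
      have a2 := norm_le_norm_add_norm_sub (c' x) (v n)
      constructor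
      · have : ‖v n‖₊ ≤ ‖c' x‖₊ + ε := by
          rw [← NNReal.coe_le_coe]; push_cast; linarith
        simpa [enorm_eq_nnnorm] using ENNReal.coe_le_coe.2 this
      · have : ‖c' x‖₊ ≤ ‖v n‖₊ + ε := by
          rw [← NNReal.coe_le_coe]; push_cast; linarith
        simpa [enorm_eq_nnnorm] using ENNReal.coe_le_coe.2 this
    have hup : ∀ n, Measure.hausdorffMeasure 1 (c '' u n) ≤
        (∫⁻ t in u n, ‖c' t‖ₑ) + 2 * ε * volume (u n) := by
      intro n
      refine (hausdorffMeasure_image_le_of_approx (h1 n)).trans ?_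
      have : ‖v n‖ₑ * volume (u n) ≤ ∫⁻ t in u n, (‖c' t‖ₑ + ε) := by
        rw [← setLIntegral_const]
        exact setLIntegral_mono' (hu n) fun x hx => (hle n x hx).1
      rw [lintegral_add_right _ measurable_const, setLIntegral_const] at this
      calc (‖v n‖ₑ + ε) * volume (u n) = ‖v n‖ₑ * volume (u n) + ε * volume (u n) := by ring
        _ ≤ _ := add_le_add_left this _
        _ = _ := by ring
    have hlo : ∀ n, (∫⁻ t in u n, ‖c' t‖ₑ) ≤
        Measure.hausdorffMeasure 1 (c '' u n) + 2 * ε * volume (u n) := by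
      intro n
      have : (∫⁻ t in u n, ‖c' t‖ₑ) ≤ (‖v n‖ₑ + ε) * volume (u n) := by
        rw [← setLIntegral_const]
        exact setLIntegral_mono' (hu n) fun x hx => (hle n x hx).2
      refine this.trans ?_
      calc (‖v n‖ₑ + ε) * volume (u n) = ‖v n‖ₑ * volume (u n) + ε * volume (u n) := by ring
        _ ≤ _ := add_le_add_left (le_hausdorffMeasure_image_of_approx (h1 n)) _
        _ = _ := by ring
    have hcu : c '' s = ⋃ n, c '' u n := by rw [← hus, image_iUnion]
    have husub : ∀ n, u n ⊆ s := fun n => hus ▸ subset_iUnion u n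
    have hcont : ContinuousOn c s := fun t ht => (hc t ht).continuousWithinAt
    have hsum : Measure.hausdorffMeasure 1 (c '' s) =
        ∑' n, Measure.hausdorffMeasure 1 (c '' u n) := by
      rw [hcu]
      refine measure_iUnion (fun m n hmn => ?_) fun n => ?_
      · exact disjoint_iff_inter_eq_empty.2 (by
          rw [← hinj.image_inter (husub m) (husub n), (hd hmn).inter_eq, image_empty])
      · exact (hu n).image_of_continuousOn_injOn (hcont.mono (husub n)) (hinj.mono (husub n))
    have hint : (∫⁻ t in s, ‖c' t‖ₑ) = ∑' n, ∫⁻ t in u n, ‖c' t‖ₑ := by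
      rw [← hus]; exact lintegral_iUnion hu hd _
    have hvol : 2 * (ε : ℝ≥0∞) * volume s = ∑' n, 2 * ε * volume (u n) := by
      rw [ENNReal.tsum_mul_left, ← measure_iUnion hd hu, hus]
    rw [hsum, hint, hvol, ← ENNReal.tsum_add, ← ENNReal.tsum_add]
    exact ⟨ENNReal.tsum_le_tsum hup, ENNReal.tsum_le_tsum hlo⟩
  have lim : ∀ a : ℝ≥0∞, Filter.Tendsto (fun ε : NNReal => a + 2 * (ε : ℝ≥0∞) * volume s)
      (nhdsWithin 0 (Ioi 0)) (nhds a) := by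
    intro a
    have : Filter.Tendsto (fun ε : NNReal => a + 2 * (ε : ℝ≥0∞) * volume s) (nhds 0)
        (nhds (a + 2 * ((0 : NNReal) : ℝ≥0∞) * volume s)) := by
      refine tendsto_const_nhds.add (ENNReal.Tendsto.mul_const ?_ (.inr hfin))
      exact ENNReal.Tendsto.const_mul (ENNReal.tendsto_coe.2 Filter.tendsto_id)
        (.inr ENNReal.ofNat_ne_top)
    simpa using this.mono_left nhdsWithin_le_nhds
  apply le_antisymm
  · refine ge_of_tendsto (lim _) ?_
    filter_upwards [self_mem_nhdsWithin] with ε hε using (key ε hε).1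
  · refine ge_of_tendsto (lim _) ?_
    filter_upwards [self_mem_nhdsWithin] with ε hε using (key ε hε).2

/-- The one-dimensional area formula: the length of an injective curve is the integral of its
speed. -/
lemma hausdorffMeasure_image_curve [SecondCountableTopology E] {c c' : ℝ → E} {s : Set ℝ}
    (hs : MeasurableSet s)
    (hc : ∀ t ∈ s, HasDerivWithinAt c (c' t) s t) (hm : Measurable c') (hinj : InjOn c s) :
    Measure.hausdorffMeasure 1 (c '' s) = ∫⁻ t in s, ‖c' t‖ₑ := by
  let u : ℕ → Set ℝ := disjointed fun n => s ∩ Ioo (-(n : ℝ)) n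
  have hu0 : ∀ n : ℕ, MeasurableSet (s ∩ Ioo (-(n : ℝ)) n) := fun n => hs.inter measurableSet_Ioo
  have hu : ∀ n, MeasurableSet (u n) := MeasurableSet.disjointed hu0
  have hus' : ∀ n, u n ⊆ s ∩ Ioo (-(n : ℝ)) n := disjointed_subset _
  have husub : ∀ n, u n ⊆ s := fun n => (hus' n).trans inter_subset_left
  have hd : Pairwise (Function.onFun Disjoint u) := disjoint_disjointed _
  have hus : (⋃ n, u n) = s := by
    simp only [u, iUnion_disjointed, ← inter_iUnion]
    refine inter_eq_left.2 fun t _ => ?_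
    obtain ⟨n, hn⟩ := exists_nat_gt |t|
    exact mem_iUnion.2 ⟨n, abs_lt.1 hn⟩
  have hcont : ContinuousOn c s := fun t ht => (hc t ht).continuousWithinAt
  have hsum : Measure.hausdorffMeasure 1 (c '' s) =
      ∑' n, Measure.hausdorffMeasure 1 (c '' u n) := by
    conv_lhs => rw [← hus, image_iUnion]
    refine measure_iUnion (fun m n hmn => ?_) fun n => ?_
    · exact disjoint_iff_inter_eq_empty.2 (by
        rw [← hinj.image_inter (husub m) (husub n), (hd hmn).inter_eq, image_empty])
    · exact (hu n).image_of_continuousOn_injOn (hcont.mono (husub n)) (hinj.mono (husub n))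
  have hint : (∫⁻ t in s, ‖c' t‖ₑ) = ∑' n, ∫⁻ t in u n, ‖c' t‖ₑ := by
    conv_lhs => rw [← hus]
    exact lintegral_iUnion hu hd _
  rw [hsum, hint]
  congr 1 with n
  refine hausdorffMeasure_image_curve_aux (hu n) (fun t ht => (hc t (husub n ht)).mono (husub n))
    hm (hinj.mono (husub n)) (ne_top_of_le_ne_top ?_ (measure_mono (hus' n)))
  exact ne_top_of_le_ne_top (by simp) (measure_mono inter_subset_right)

/-- Integration over an injective curve with respect to length is integration over the parameter
with the speed as a density. -/
lemma hausdorffMeasure_restrict_curve [SecondCountableTopology E] {c c' : ℝ → E} {s : Set ℝ}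
    (hs : MeasurableSet s)
    (hc : ∀ t ∈ s, HasDerivWithinAt c (c' t) s t) (hm : Measurable c') (hcm : Measurable c)
    (hinj : InjOn c s) :
    (Measure.hausdorffMeasure 1).restrict (c '' s) =
      ((volume.restrict s).withDensity fun t => ‖c' t‖ₑ).map c := by
  ext a ha
  rw [Measure.restrict_apply ha, Measure.map_apply hcm ha, withDensity_apply _ (hcm ha),
    Measure.restrict_restrict (hcm ha),
    ← hausdorffMeasure_image_curve ((hcm ha).inter hs)
      (fun t ht => (hc t ht.2).mono inter_subset_right) hm (hinj.mono inter_subset_right),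
    image_preimage_inter]

end CurveLength

/-! ### Triple products -/

/-- The parameter plane. -/
abbrev Plane := EuclideanSpace ℝ (Fin 2)

/-- The ambient space. -/
abbrev Space := EuclideanSpace ℝ (Fin 3)

/-- The determinant of the matrix with the columns `a`, `b`, `c`. -/
def tripleProduct (a b c : Space) : ℝ :=
  a 0 * (b 1 * c 2 - b 2 * c 1) - a 1 * (b 0 * c 2 - b 2 * c 0) + a 2 * (b 0 * c 1 - b 1 * c 0)

/-- The determinant of the matrix with the columns `p`, `q`. -/
def wedge (p q : Plane) : ℝ := p 0 * q 1 - p 1 * q 0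

lemma inner_space (a b : Space) : inner ℝ a b = a 0 * b 0 + a 1 * b 1 + a 2 * b 2 := by
  simp [PiLp.inner_apply, Fin.sum_univ_three, mul_comm]

lemma inner_plane (a b : Plane) : inner ℝ a b = a 0 * b 0 + a 1 * b 1 := by
  simp [PiLp.inner_apply, mul_comm]

/-- The product of two determinants is the determinant of the matrix of inner products. -/
lemma tripleProduct_mul (a b c u v w : Space) :
    tripleProduct a b c * tripleProduct u v w =
      inner ℝ a u * (inner ℝ b v * inner ℝ c w - inner ℝ b w * inner ℝ c v) -
      inner ℝ a v * (inner ℝ b u * inner ℝ c w - inner ℝ b w * inner ℝ c u) +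
      inner ℝ a w * (inner ℝ b u * inner ℝ c v - inner ℝ b v * inner ℝ c u) := by
  simp only [inner_space, tripleProduct]; ring

lemma tripleProduct_map_sq (G : Space ≃ₗᵢ[ℝ] Space) (a b c : Space) :
    tripleProduct (G a) (G b) (G c) ^ 2 = tripleProduct a b c ^ 2 := by
  simp only [sq, tripleProduct_mul, LinearIsometryEquiv.inner_map_map]

lemma eq_zero_of_tripleProduct_ne_zero {a b c d : Space} (h : tripleProduct a b c ≠ 0)
    (ha : inner ℝ a d = 0) (hb : inner ℝ b d = 0) (hc : inner ℝ c d = 0) : d = 0 := by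
  rw [inner_space] at ha hb hc
  have key : ∀ i, tripleProduct a b c * d i = 0 := by
    intro i
    fin_cases i <;> simp only [tripleProduct, Fin.zero_eta, Fin.mk_one, Fin.reduceFinMk]
    · linear_combination (b 1 * c 2 - b 2 * c 1) * ha - (a 1 * c 2 - a 2 * c 1) * hb +
        (a 1 * b 2 - a 2 * b 1) * hc
    · linear_combination -(b 0 * c 2 - b 2 * c 0) * ha + (a 0 * c 2 - a 2 * c 0) * hb -
        (a 0 * b 2 - a 2 * b 0) * hc
    · linear_combination (b 0 * c 1 - b 1 * c 0) * ha - (a 0 * c 1 - a 1 * c 0) * hb +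
        (a 0 * b 1 - a 1 * b 0) * hc
  ext i
  exact (mul_eq_zero.1 (key i)).resolve_left h

/-- The explicit vector is Cramer's rule. -/
lemma exists_inner_eq {a b c : Space} (h : tripleProduct a b c ≠ 0) (α β γ : ℝ) :
    ∃ d : Space, inner ℝ a d = α ∧ inner ℝ b d = β ∧ inner ℝ c d = γ := by
  refine ⟨(tripleProduct a b c)⁻¹ • !₂[
    α * (b 1 * c 2 - b 2 * c 1) - β * (a 1 * c 2 - a 2 * c 1) + γ * (a 1 * b 2 - a 2 * b 1),
    -α * (b 0 * c 2 - b 2 * c 0) + β * (a 0 * c 2 - a 2 * c 0) - γ * (a 0 * b 2 - a 2 * b 0),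
    α * (b 0 * c 1 - b 1 * c 0) - β * (a 0 * c 1 - a 1 * c 0) + γ * (a 0 * b 1 - a 1 * b 0)],
    ?_, ?_, ?_⟩ <;>
  · rw [inner_smul_right, inv_mul_eq_iff_eq_mul₀ h]
    simp only [inner_space, tripleProduct, Matrix.cons_val_zero,
      Matrix.cons_val_one, Matrix.cons_val]
    ring

lemma sin_angle_sq {a b : Space} (ha : ‖a‖ = 1) (hb : ‖b‖ = 1) :
    Real.sin (InnerProductGeometry.angle a b) ^ 2 = 1 - inner ℝ a b ^ 2 := by
  rw [Real.sin_sq, InnerProductGeometry.cos_angle, ha, hb, mul_one, div_one]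

lemma sin_angle_pos {a b c : Space} (ha : ‖a‖ = 1) (hb : ‖b‖ = 1) (h : tripleProduct a b c ≠ 0) :
    0 < Real.sin (InnerProductGeometry.angle a b) := by
  refine lt_of_le_of_ne (InnerProductGeometry.sin_angle_nonneg _ _) fun hs => h ?_
  have h2 := tripleProduct_mul a b c a b c
  have haa : inner ℝ a a = (1 : ℝ) := by rw [real_inner_self_eq_norm_sq, ha]; norm_num
  have hbb : inner ℝ b b = (1 : ℝ) := by rw [real_inner_self_eq_norm_sq, hb]; norm_num
  have e0 := sin_angle_sq ha hb
  rw [← hs] at e0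
  rw [haa, hbb, real_inner_comm a b, real_inner_comm a c, real_inner_comm b c] at h2
  -- with `⟨a, b⟩ = ± 1`, the Gram determinant is minus a square
  have h3 : tripleProduct a b c ^ 2 =
      -(inner ℝ a c - inner ℝ a b * inner ℝ b c) ^ 2 := by
    linear_combination h2 - (inner ℝ c c - inner ℝ b c ^ 2) * e0
  nlinarith [sq_nonneg (inner ℝ a c - inner ℝ a b * inner ℝ b c : ℝ),
    sq_nonneg (tripleProduct a b c)]

/-- The length of a vector `v` orthogonal to two unit vectors `a`, `b`, in terms of its component
along a third vector `c`. -/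
lemma norm_mul_abs_tripleProduct {a b c v : Space} (ha : ‖a‖ = 1) (hb : ‖b‖ = 1)
    (h : tripleProduct a b c ≠ 0) (hav : inner ℝ a v = 0) (hbv : inner ℝ b v = 0) :
    ‖v‖ * |tripleProduct a b c| =
      Real.sin (InnerProductGeometry.angle a b) * |inner ℝ c v| := by
  have hs := sin_angle_pos ha hb h
  have e0 := sin_angle_sq ha hb
  have haa : inner ℝ a a = (1 : ℝ) := by rw [real_inner_self_eq_norm_sq, ha]; norm_num
  have hbb : inner ℝ b b = (1 : ℝ) := by rw [real_inner_self_eq_norm_sq, hb]; norm_num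
  have h1 := tripleProduct_mul a b v a b c
  have h2 := tripleProduct_mul a b v a b v
  rw [haa, hbb, real_inner_comm a b, real_inner_comm a v, real_inner_comm b v, hav, hbv] at h1 h2
  rw [real_inner_self_eq_norm_sq] at h2
  rw [← sq_eq_sq₀ (by positivity) (by positivity), mul_pow, mul_pow, sq_abs, sq_abs,
    ← mul_right_inj' (pow_pos hs 2).ne']
  rw [real_inner_comm c v] at h1
  set s := Real.sin (InnerProductGeometry.angle a b)
  set m : ℝ := inner ℝ a b
  set r : ℝ := inner ℝ c v
  have h1' : tripleProduct a b v * tripleProduct a b c = s ^ 2 * r := by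
    rw [e0, h1]; ring
  have h2' : tripleProduct a b v ^ 2 = s ^ 2 * ‖v‖ ^ 2 := by
    rw [e0, sq, h2]; ring
  calc s ^ 2 * (‖v‖ ^ 2 * tripleProduct a b c ^ 2)
      = (tripleProduct a b v * tripleProduct a b c) ^ 2 := by rw [mul_pow, h2']; ring
    _ = _ := by rw [h1']; ring

/-! ### Tangent planes and normals of a rotated graph -/

namespace RotatedGraph

variable (S : RotatedGraph)

/-- The density `√(1 + |∇F|²)` of the surface measure. -/
noncomputable def weight (p : Plane) : ℝ := Real.sqrt (1 + ‖gradient S.F p‖ ^ 2)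

lemma weight_pos (p : Plane) : 0 < S.weight p := Real.sqrt_pos.2 (by positivity)

/-- The derivative of the parametrization. -/
noncomputable def tangent (p : Plane) : Plane →L[ℝ] Space :=
  (S.G : Space →L[ℝ] Space) ∘L LinearMap.toContinuousLinearMap
    { toFun := fun q => !₂[q 0, q 1, inner ℝ (gradient S.F p) q]
      map_add' := fun q r => by
        ext i; fin_cases i <;> simp [inner_add_right]
      map_smul' := fun c q => by
        ext i; fin_cases i <;> simp [inner_smul_right] }

lemma tangent_apply (p q : Plane) :
    S.tangent p q = S.G !₂[q 0, q 1, inner ℝ (gradient S.F p) q] := rfl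

@[simp] lemma base_param (p : Plane) : S.base (S.param p) = p := by
  ext i
  fin_cases i <;> simp [base, param]

lemma normal_param (p : Plane) : S.normal (S.param p) =
    S.G ((S.weight p)⁻¹ • !₂[-(gradient S.F p 0), -(gradient S.F p 1), 1]) := by
  rw [normal, base_param, weight]

lemma norm_normal (σ : Space) : ‖S.normal σ‖ = 1 := by
  have h : ‖(!₂[-(gradient S.F (S.base σ) 0), -(gradient S.F (S.base σ) 1), 1] : Space)‖ =
      S.weight (S.base σ) := by
    rw [EuclideanSpace.norm_eq, weight, EuclideanSpace.norm_eq, Real.sq_sqrt (by positivity)]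
    congr 1
    simp [Fin.sum_univ_three]
    ring
  rw [normal, LinearIsometryEquiv.norm_map, norm_smul, h, norm_inv, Real.norm_eq_abs]
  change |S.weight _|⁻¹ * _ = 1
  rw [abs_of_pos (S.weight_pos _), inv_mul_cancel₀ (S.weight_pos _).ne']

lemma inner_normal_map (p : Plane) (v : Space) :
    S.weight p * inner ℝ (S.normal (S.param p)) (S.G v) =
    v 2 - gradient S.F p 0 * v 0 - gradient S.F p 1 * v 1 := by
  rw [normal_param, LinearIsometryEquiv.inner_map_map, inner_smul_left]
  simp only [RCLike.conj_to_real]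
  rw [mul_inv_cancel_left₀ (S.weight_pos p).ne', inner_space]
  simp
  ring

@[simp] lemma inner_normal_tangent (p q : Plane) :
    inner ℝ (S.normal (S.param p)) (S.tangent p q) = 0 := by
  have := S.inner_normal_map p !₂[q 0, q 1, inner ℝ (gradient S.F p) q]
  rw [← tangent_apply] at this
  refine (mul_eq_zero.1 (this.trans ?_)).resolve_left (S.weight_pos p).ne'
  rw [inner_plane]
  simp

lemma exists_tangent_eq {p : Plane} {v : Space} (hv : inner ℝ (S.normal (S.param p)) v = 0) :
    ∃ q, S.tangent p q = v := by
  have := S.inner_normal_map p (S.G.symm v)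
  rw [LinearIsometryEquiv.apply_symm_apply, hv, mul_zero] at this
  refine ⟨S.base v, ?_⟩
  rw [tangent_apply, ← LinearIsometryEquiv.eq_symm_apply]
  ext i
  fin_cases i
  · simp [base]
  · simp [base]
  · change inner ℝ (gradient S.F p) (S.base v) = S.G.symm v 2
    rw [inner_plane]
    simp only [base, Matrix.cons_val_zero, Matrix.cons_val_one]
    linarith

lemma tangent_injective (p : Plane) : Function.Injective (S.tangent p) := by
  intro q r h
  rw [tangent_apply, tangent_apply, S.G.injective.eq_iff] at h
  ext i
  fin_cases i
  · simpa using congrArg (fun v : Space => v 0) h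
  · simpa using congrArg (fun v : Space => v 1) h

/-- The parametrization multiplies areas by `√(1 + |∇F|²)`. -/
lemma abs_tripleProduct_tangent (p q r : Plane) (v : Space) :
    |tripleProduct (S.tangent p q) (S.tangent p r) v| =
      |wedge q r| * (S.weight p * |inner ℝ (S.normal (S.param p)) v|) := by
  have h1 := tripleProduct_map_sq S.G !₂[q 0, q 1, inner ℝ (gradient S.F p) q]
    !₂[r 0, r 1, inner ℝ (gradient S.F p) r] (S.G.symm v)
  have h2 := S.inner_normal_map p (S.G.symm v)
  rw [LinearIsometryEquiv.apply_symm_apply] at h1 h2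
  rw [← abs_of_pos (S.weight_pos p), ← abs_mul, ← abs_mul, ← sq_eq_sq_iff_abs_eq_abs, h2,
    tangent_apply, tangent_apply, h1]
  congr 1
  simp only [tripleProduct, wedge, inner_plane, Matrix.cons_val_zero,
      Matrix.cons_val_one, Matrix.cons_val]
  ring

variable {S}

lemma hasStrictFDerivAt_param (hU : IsOpen S.U) (hF : ContDiffOn ℝ 1 S.F S.U) {p : Plane}
    (hp : p ∈ S.U) : HasStrictFDerivAt S.param (S.tangent p) p := by
  have h1 : HasStrictFDerivAt S.F (fderiv ℝ S.F p) p :=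
    (hF.contDiffAt (hU.mem_nhds hp)).hasStrictFDerivAt one_ne_zero
  have h2 : HasStrictFDerivAt (fun q : Plane => (!₂[q 0, q 1, S.F q] : Space))
      (LinearMap.toContinuousLinearMap
    { toFun := fun q => !₂[q 0, q 1, inner ℝ (gradient S.F p) q]
      map_add' := fun q r => by
        ext i; fin_cases i <;> simp [inner_add_right]
      map_smul' := fun c q => by
        ext i; fin_cases i <;> simp [inner_smul_right] } : Plane →L[ℝ] Space) p := by
    rw [hasStrictFDerivAt_euclidean]
    intro i
    fin_cases i
    · exact (EuclideanSpace.proj (𝕜 := ℝ) (0 : Fin 2)).hasStrictFDerivAt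
    · exact (EuclideanSpace.proj (𝕜 := ℝ) (1 : Fin 2)).hasStrictFDerivAt
    · refine h1.congr_fderiv ?_
      ext q
      exact inner_gradient_left.symm
  exact (S.G : Space →L[ℝ] Space).hasStrictFDerivAt.comp p h2

lemma continuousOn_param (hU : IsOpen S.U) (hF : ContDiffOn ℝ 1 S.F S.U) :
    ContinuousOn S.param S.U := fun _ hp =>
  (hasStrictFDerivAt_param hU hF hp).hasFDerivAt.continuousAt.continuousWithinAt

/-- The mean value theorem: every chord of the graph is tangent to it at some point. -/
lemma exists_inner_normal_sub_eq_zero (hU : IsOpen S.U) (hc : Convex ℝ S.U)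
    (hF : ContDiffOn ℝ 1 S.F S.U) {p q : Plane} (hp : p ∈ S.U) (hq : q ∈ S.U) :
    ∃ r ∈ S.U, inner ℝ (S.normal (S.param r)) (S.param q - S.param p) = 0 := by
  obtain ⟨r, hr, h⟩ := domain_mvt (f := S.F) (f' := fderiv ℝ S.F) (fun x hx =>
    (((hF.contDiffAt (hU.mem_nhds hx)).hasStrictFDerivAt
      one_ne_zero).hasFDerivAt).hasFDerivWithinAt) hc hp hq
  refine ⟨r, hc.segment_subset hp hq hr, ?_⟩
  have h1 := S.inner_normal_map r !₂[q 0 - p 0, q 1 - p 1, S.F q - S.F p]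
  have h2 : S.param q - S.param p = S.G !₂[q 0 - p 0, q 1 - p 1, S.F q - S.F p] := by
    rw [param, param, ← map_sub]
    congr 1
    ext i; fin_cases i <;> simp
  rw [h2]
  refine (mul_eq_zero.1 (h1.trans ?_)).resolve_left (S.weight_pos r).ne'
  have h3 : fderiv ℝ S.F r (q - p) = inner ℝ (gradient S.F r) (q - p) := by simp
  rw [h3, inner_plane] at h
  simp at h ⊢
  linarith

lemma measurable_gradient (F : Plane → ℝ) : Measurable (gradient F) :=
  (InnerProductSpace.toDual ℝ Plane).symm.continuous.measurable.comp (measurable_fderiv ℝ F)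

variable (S) in
lemma measurable_weight : Measurable S.weight := by
  have := measurable_gradient S.F
  unfold weight
  fun_prop

variable (S) in
lemma measurable_normal : Measurable S.normal := by
  have hb : Measurable S.base := by
    unfold base
    refine (PiLp.continuous_toLp 2 _).measurable.comp (measurable_pi_iff.2 fun i => ?_)
    have := S.G.symm.continuous.measurable
    fin_cases i <;> simp <;> fun_prop
  have hg := (measurable_gradient S.F).comp hb
  unfold normal
  refine S.G.continuous.measurable.comp (Measurable.fun_smul ?_ ?_)
  · exact (S.measurable_weight.comp hb).inv
  · refine (PiLp.continuous_toLp 2 _).measurable.comp (measurable_pi_iff.2 fun i => ?_)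
    have h0 : Measurable fun σ => gradient S.F (S.base σ) 0 :=
      (EuclideanSpace.proj (𝕜 := ℝ) (0 : Fin 2)).measurable.comp hg
    have h1 : Measurable fun σ => gradient S.F (S.base σ) 1 :=
      (EuclideanSpace.proj (𝕜 := ℝ) (1 : Fin 2)).measurable.comp hg
    fin_cases i
    · exact h0.neg
    · exact h1.neg
    · exact measurable_const

end RotatedGraph

/-! ### A block determinant -/

/-- The linear map of the plane with the columns `p`, `q`. -/
noncomputable def columns (p q : Plane) : Plane →ₗ[ℝ] Plane where
  toFun v := v 0 • p + v 1 • q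
  map_add' v w := by simp only [PiLp.add_apply]; module
  map_smul' c v := by simp only [PiLp.smul_apply, smul_eq_mul, RingHom.id_apply]; module

lemma det_columns (p q : Plane) : (columns p q).det = wedge p q := by
  rw [← LinearMap.det_toMatrix (EuclideanSpace.basisFun (Fin 2) ℝ).toBasis, Matrix.det_fin_two]
  simp [LinearMap.toMatrix_apply, columns, wedge]
  ring

/-- The determinant of a linear map of `ℝ² × ℝ²` which takes a suitable basis to vectors in the two
factors. -/
lemma abs_det_mul_wedge (L : Plane × Plane →ₗ[ℝ] Plane × Plane) {q₁ q₂ a₁ b₁ a₂ b₂ : Plane} {d : ℝ}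
    (h₁ : L (0, !₂[1, 0]) = (a₁, 0)) (h₂ : L (0, !₂[0, 1]) = (0, a₂)) (h₃ : L (q₁, 0) = (0, b₂))
    (h₄ : L (q₂, !₂[0, d]) = (b₁, 0)) :
    |L.det| * |wedge q₁ q₂| = |wedge a₁ b₁| * |wedge a₂ b₂| := by
  let B : Plane × Plane →ₗ[ℝ] Plane × Plane :=
    { toFun := fun v => (v.1 1 • q₂ + v.2 1 • q₁, !₂[v.1 0, v.2 0 + d * v.1 1])
      map_add' := fun v w => by
        ext i
        · simp; ring
        · fin_cases i <;> simp; ring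
      map_smul' := fun c v => by
        ext i
        · simp; ring
        · fin_cases i <;> simp; ring }
  have hB : |B.det| = |wedge q₁ q₂| := by
    let e := ((EuclideanSpace.basisFun (Fin 2) ℝ).toBasis.prod
      (EuclideanSpace.basisFun (Fin 2) ℝ).toBasis).reindex finSumFinEquiv
    have h : LinearMap.toMatrix e e B =
        !![0, q₂ 0, 0, q₁ 0; 0, q₂ 1, 0, q₁ 1; 1, 0, 0, 0; 0, d, 1, 0] := by
      ext i j
      have f0 : (finSumFinEquiv (m := 2) (n := 2)).symm 0 = Sum.inl 0 := rfl
      have f1 : (finSumFinEquiv (m := 2) (n := 2)).symm 1 = Sum.inl 1 := rfl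
      have f2 : (finSumFinEquiv (m := 2) (n := 2)).symm 2 = Sum.inr 0 := rfl
      have f3 : (finSumFinEquiv (m := 2) (n := 2)).symm 3 = Sum.inr 1 := rfl
      fin_cases i <;> fin_cases j <;>
        simp [LinearMap.toMatrix_apply, B, e, f0, f1, f2, f3]
    rw [← LinearMap.det_toMatrix e, h, Matrix.det_succ_row_zero]
    simp [Fin.sum_univ_succ, Matrix.det_fin_three, Fin.succAbove, wedge]
    congr 1
    ring
  have hLB : L ∘ₗ B = (columns a₁ b₁).prodMap (columns a₂ b₂) := by
    apply LinearMap.ext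
    intro v
    have : B v = v.1 0 • ((0 : Plane), (!₂[1, 0] : Plane)) + v.1 1 • (q₂, (!₂[0, d] : Plane)) +
        v.2 0 • ((0 : Plane), (!₂[0, 1] : Plane)) + v.2 1 • (q₁, (0 : Plane)) := by
      ext i
      · simp [B]
      · fin_cases i <;> simp [B]; ring
    rw [LinearMap.comp_apply, this]
    simp only [map_add, map_smul, h₁, h₂, h₃, h₄]
    ext i <;> simp [columns]
  rw [← hB, ← abs_mul, ← LinearMap.det_comp, hLB, LinearMap.det_prodMap, det_columns, det_columns,
    abs_mul]

/-! ### The sum of two surfaces -/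

namespace RotatedGraph

open Set

/-- A graph of class `C¹` over an open convex set. -/
structure IsRegular (S : RotatedGraph) : Prop where
  isOpen : IsOpen S.U
  convex : Convex ℝ S.U
  contDiffOn : ContDiffOn ℝ 1 S.F S.U

/-- Two surfaces of class `C¹` whose normals are, at all pairs of points, linearly independent
together with the fixed vector `N`. -/
structure TransversePair (S₁ S₂ : RotatedGraph) (N : Space) : Prop where
  left : S₁.IsRegular
  right : S₂.IsRegular
  pos : ∀ p ∈ S₁.U, ∀ q ∈ S₂.U,
    0 < tripleProduct (S₁.normal (S₁.param p)) (S₂.normal (S₂.param q)) N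

/-- The map `(σ₁, σ₂) ↦ (σ₁ + σ₂, ⟨N, σ₁⟩)` on pairs of points of the two surfaces. The second
component serves as a parameter on the curves `S₁ ∩ (x - S₂)`. -/
noncomputable def sumHeight (S₁ S₂ : RotatedGraph) (N : Space) (p : Plane × Plane) : Space × ℝ :=
  (S₁.param p.1 + S₂.param p.2, inner ℝ N (S₁.param p.1))

/-- The range of `sumHeight`. -/
def sumRange (S₁ S₂ : RotatedGraph) (N : Space) : Set (Space × ℝ) :=
  sumHeight S₁ S₂ N '' (S₁.U ×ˢ S₂.U)

/-- The inverse of `sumHeight` on `sumRange`; the values elsewhere are arbitrary. -/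
noncomputable def split (S₁ S₂ : RotatedGraph) (N : Space) : Space × ℝ → Plane × Plane :=
  Function.invFunOn (sumHeight S₁ S₂ N) (S₁.U ×ˢ S₂.U)

variable {S₁ S₂ : RotatedGraph} {N : Space}

lemma param_injective (S : RotatedGraph) : Function.Injective S.param :=
  Function.LeftInverse.injective S.base_param

lemma split_mem {ω : Space × ℝ} (hω : ω ∈ sumRange S₁ S₂ N) :
    (split S₁ S₂ N ω).1 ∈ S₁.U ∧ (split S₁ S₂ N ω).2 ∈ S₂.U :=
  Function.invFunOn_mem hω

lemma sumHeight_split {ω : Space × ℝ} (hω : ω ∈ sumRange S₁ S₂ N) :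
    sumHeight S₁ S₂ N (split S₁ S₂ N ω) = ω :=
  Function.invFunOn_eq hω

namespace TransversePair

variable (h : TransversePair S₁ S₂ N)
include h

/-- If two pairs of points have the same image, the difference of the first points is a chord of
both surfaces that is orthogonal to `N`; transversality excludes this. -/
lemma injOn_sumHeight : InjOn (sumHeight S₁ S₂ N) (S₁.U ×ˢ S₂.U) := by
  rintro ⟨p, q⟩ ⟨hp, hq⟩ ⟨p', q'⟩ ⟨hp', hq'⟩ heq
  simp only [sumHeight, Prod.mk.injEq] at heq hp hq hp' hq'
  obtain ⟨r, hr, h1⟩ := exists_inner_normal_sub_eq_zero h.left.isOpen h.left.convex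
    h.left.contDiffOn hp' hp
  obtain ⟨r', hr', h2⟩ := exists_inner_normal_sub_eq_zero h.right.isOpen h.right.convex
    h.right.contDiffOn hq hq'
  have hd : S₂.param q' - S₂.param q = S₁.param p - S₁.param p' := by
    rw [sub_eq_sub_iff_add_eq_add, add_comm, ← heq.1, add_comm]
  rw [hd] at h2
  have h0 := eq_zero_of_tripleProduct_ne_zero (h.pos r hr r' hr').ne' h1 h2
    (by rw [inner_sub_right, heq.2, sub_self])
  rw [h0] at hd
  exact Prod.ext (S₁.param_injective (sub_eq_zero.1 h0))
    (S₂.param_injective (sub_eq_zero.1 hd)).symm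

lemma exists_hasStrictFDerivAt_sumHeight {p : Plane × Plane} (hp : p ∈ S₁.U ×ˢ S₂.U) :
    ∃ A : (Plane × Plane) ≃L[ℝ] (Space × ℝ),
      HasStrictFDerivAt (sumHeight S₁ S₂ N) (A : Plane × Plane →L[ℝ] Space × ℝ) p ∧
      ∀ v, A v = (S₁.tangent p.1 v.1 + S₂.tangent p.2 v.2, inner ℝ N (S₁.tangent p.1 v.1)) := by
  have d1 : HasStrictFDerivAt (fun p : Plane × Plane => S₁.param p.1)
      (S₁.tangent p.1 ∘L ContinuousLinearMap.fst ℝ Plane Plane) p :=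
    (hasStrictFDerivAt_param h.left.isOpen h.left.contDiffOn hp.1).comp p hasStrictFDerivAt_fst
  have d2 : HasStrictFDerivAt (fun p : Plane × Plane => S₂.param p.2)
      (S₂.tangent p.2 ∘L ContinuousLinearMap.snd ℝ Plane Plane) p :=
    (hasStrictFDerivAt_param h.right.isOpen h.right.contDiffOn hp.2).comp p hasStrictFDerivAt_snd
  have d3 : HasStrictFDerivAt (fun p : Plane × Plane => (inner ℝ N (S₁.param p.1) : ℝ))
      (innerSL ℝ N ∘L (S₁.tangent p.1 ∘L ContinuousLinearMap.fst ℝ Plane Plane)) p :=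
    (innerSL ℝ N).hasStrictFDerivAt.comp p d1
  have d := (d1.add d2).prodMk d3
  set L := (S₁.tangent p.1 ∘L ContinuousLinearMap.fst ℝ Plane Plane +
    S₂.tangent p.2 ∘L ContinuousLinearMap.snd ℝ Plane Plane).prod
    (innerSL ℝ N ∘L (S₁.tangent p.1 ∘L ContinuousLinearMap.fst ℝ Plane Plane)) with hL
  have hLv : ∀ v, L v =
      (S₁.tangent p.1 v.1 + S₂.tangent p.2 v.2, inner ℝ N (S₁.tangent p.1 v.1)) := fun v => rfl
  have hinj : Function.Injective L := by
    refine (injective_iff_map_eq_zero L).2 fun v hv => ?_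
    rw [hLv, Prod.mk_eq_zero] at hv
    have h1 : S₁.tangent p.1 v.1 = -S₂.tangent p.2 v.2 := eq_neg_of_add_eq_zero_left hv.1
    have h0 : S₁.tangent p.1 v.1 = 0 :=
      eq_zero_of_tripleProduct_ne_zero (h.pos p.1 hp.1 p.2 hp.2).ne'
        (S₁.inner_normal_tangent _ _) (by rw [h1, inner_neg_right, inner_normal_tangent, neg_zero])
        hv.2
    rw [h0, zero_add] at hv
    exact Prod.ext (S₁.tangent_injective p.1 (by rw [h0]; simp))
      (S₂.tangent_injective p.2 (by rw [hv.1]; simp))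
  have hrank : Module.finrank ℝ (Plane × Plane) = Module.finrank ℝ (Space × ℝ) := by simp
  refine ⟨(LinearEquiv.ofInjectiveOfFinrankEq (L : Plane × Plane →ₗ[ℝ] Space × ℝ)
    hinj hrank).toContinuousLinearEquiv, ?_, fun v => hLv v⟩
  have d' : HasStrictFDerivAt (sumHeight S₁ S₂ N) L p := d
  exact d'.congr_fderiv (ContinuousLinearMap.ext fun _ => rfl)

lemma sumRange_mem_nhds_and_hasFDerivAt_split {ω : Space × ℝ} (hω : ω ∈ sumRange S₁ S₂ N) :
    sumRange S₁ S₂ N ∈ nhds ω ∧ ∃ L : Space × ℝ →L[ℝ] Plane × Plane,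
      HasFDerivAt (split S₁ S₂ N) L ω ∧ ∀ v,
      S₁.tangent (split S₁ S₂ N ω).1 (L v).1 + S₂.tangent (split S₁ S₂ N ω).2 (L v).2 = v.1 ∧
      inner ℝ N (S₁.tangent (split S₁ S₂ N ω).1 (L v).1) = v.2 := by
  have hp : split S₁ S₂ N ω ∈ S₁.U ×ˢ S₂.U := split_mem hω
  obtain ⟨A, hA, hAv⟩ := h.exists_hasStrictFDerivAt_sumHeight hp
  have hnhds := (h.left.isOpen.prod h.right.isOpen).mem_nhds hp
  have hmap := hA.map_nhds_eq_of_equiv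
  have hs := hA.to_local_left_inverse (g := split S₁ S₂ N) (by
    filter_upwards [hnhds] with p hp
    exact h.injOn_sumHeight.leftInvOn_invFunOn hp)
  rw [sumHeight_split hω] at hmap hs
  refine ⟨?_, A.symm, hs.hasFDerivAt, fun v => ?_⟩
  · rw [← hmap]
    exact Filter.image_mem_map hnhds
  · have := hAv (A.symm v)
    rw [A.apply_symm_apply] at this
    exact ⟨congrArg Prod.fst this.symm, congrArg Prod.snd this.symm⟩

lemma isOpen_sumRange : IsOpen (sumRange S₁ S₂ N) :=
  isOpen_iff_mem_nhds.2 fun _ hω => (h.sumRange_mem_nhds_and_hasFDerivAt_split hω).1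

lemma continuousOn_split : ContinuousOn (split S₁ S₂ N) (sumRange S₁ S₂ N) := fun _ hω =>
  let ⟨_, hL, _⟩ := (h.sumRange_mem_nhds_and_hasFDerivAt_split hω).2
  hL.continuousAt.continuousWithinAt

end TransversePair

/-! ### The curves `S₁ ∩ (x - S₂)` -/

open Classical in
/-- The point of the curve `S₁ ∩ (x - S₂)` at height `t`, where `ω = (x, t)`; by convention `0`
if there is no such point. -/
noncomputable def curvePoint (S₁ S₂ : RotatedGraph) (N : Space) (ω : Space × ℝ) : Space :=
  if ω ∈ sumRange S₁ S₂ N then S₁.param (split S₁ S₂ N ω).1 else 0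

/-- The set of heights of the points of the curve `S₁ ∩ (x - S₂)`. -/
def heights (S₁ S₂ : RotatedGraph) (N : Space) (x : Space) : Set ℝ :=
  {t | (x, t) ∈ sumRange S₁ S₂ N}

/-- The determinant of the normals at the two points of the surfaces given by `ω` and of `N`. -/
noncomputable def curveDet (S₁ S₂ : RotatedGraph) (N : Space) (ω : Space × ℝ) : ℝ :=
  tripleProduct (S₁.normal (curvePoint S₁ S₂ N ω)) (S₂.normal (ω.1 - curvePoint S₁ S₂ N ω)) N

/-- The sine of the angle between the normals at the two points of the surfaces given by `ω`. -/
noncomputable def curveSin (S₁ S₂ : RotatedGraph) (N : Space) (ω : Space × ℝ) : ℝ :=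
  Real.sin (InnerProductGeometry.angle (S₁.normal (curvePoint S₁ S₂ N ω))
    (S₂.normal (ω.1 - curvePoint S₁ S₂ N ω)))

lemma curvePoint_eq {ω : Space × ℝ} (hω : ω ∈ sumRange S₁ S₂ N) :
    curvePoint S₁ S₂ N ω = S₁.param (split S₁ S₂ N ω).1 := if_pos hω

lemma sub_curvePoint {ω : Space × ℝ} (hω : ω ∈ sumRange S₁ S₂ N) :
    ω.1 - curvePoint S₁ S₂ N ω = S₂.param (split S₁ S₂ N ω).2 := by
  have := congrArg Prod.fst (sumHeight_split hω)
  rw [curvePoint_eq hω, ← this, sumHeight, add_sub_cancel_left]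

lemma inner_curvePoint {ω : Space × ℝ} (hω : ω ∈ sumRange S₁ S₂ N) :
    inner ℝ N (curvePoint S₁ S₂ N ω) = ω.2 := by
  have := congrArg Prod.snd (sumHeight_split hω)
  rw [curvePoint_eq hω, ← this, sumHeight]

lemma injOn_curvePoint (x : Space) :
    InjOn (fun t => curvePoint S₁ S₂ N (x, t)) (heights S₁ S₂ N x) := by
  intro t ht t' ht' heq
  have := congrArg (inner ℝ N) heq
  simp only [inner_curvePoint ht, inner_curvePoint ht'] at this
  exact this

namespace TransversePair

variable (h : TransversePair S₁ S₂ N)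
include h

lemma image_curvePoint (x : Space) :
    (fun t => curvePoint S₁ S₂ N (x, t)) '' heights S₁ S₂ N x = convCurve S₁ S₂ x := by
  ext y
  constructor
  · rintro ⟨t, ht, rfl⟩
    have h1 := curvePoint_eq ht
    have h2 := sub_curvePoint ht
    simp only [convCurve, mem_ofPred_eq, carrier] at h1 h2 ⊢
    rw [h2, h1]
    exact ⟨⟨_, (split_mem ht).1, rfl⟩, ⟨_, (split_mem ht).2, rfl⟩⟩
  · rintro ⟨⟨p, hp, hpy⟩, q, hq, hqy⟩
    have hx : sumHeight S₁ S₂ N (p, q) = (x, inner ℝ N y) := by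
      rw [sumHeight, hpy, hqy, add_sub_cancel]
    have hs : split S₁ S₂ N (x, inner ℝ N y) = (p, q) := by
      rw [← hx]
      exact h.injOn_sumHeight.leftInvOn_invFunOn ⟨hp, hq⟩
    have hmem : (x, inner ℝ N y) ∈ sumRange S₁ S₂ N := ⟨(p, q), ⟨hp, hq⟩, hx⟩
    refine ⟨inner ℝ N y, hmem, ?_⟩
    simp only [curvePoint_eq hmem, hs, hpy]

lemma isOpen_heights (x : Space) : IsOpen (heights S₁ S₂ N x) :=
  h.isOpen_sumRange.preimage (by fun_prop : Continuous fun t : ℝ => (x, t))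

lemma measurable_curvePoint : Measurable (curvePoint S₁ S₂ N) := by
  classical
  have hc : ContinuousOn (fun ω => S₁.param (split S₁ S₂ N ω).1) (sumRange S₁ S₂ N) :=
    (continuousOn_param h.left.isOpen h.left.contDiffOn).comp
      (continuous_fst.comp_continuousOn h.continuousOn_split) fun ω hω => (split_mem hω).1
  exact hc.measurable_piecewise continuousOn_const h.isOpen_sumRange.measurableSet

lemma measurable_curveDet : Measurable (curveDet S₁ S₂ N) := by
  have h1 := S₁.measurable_normal.comp h.measurable_curvePoint
  have h2 := S₂.measurable_normal.comp (measurable_fst.sub h.measurable_curvePoint)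
  have e1 : ∀ i, Measurable fun ω => S₁.normal (curvePoint S₁ S₂ N ω) i := fun i =>
    (EuclideanSpace.proj (𝕜 := ℝ) i).measurable.comp h1
  have e2 : ∀ i, Measurable fun ω => S₂.normal (ω.1 - curvePoint S₁ S₂ N ω) i := fun i =>
    (EuclideanSpace.proj (𝕜 := ℝ) i).measurable.comp h2
  unfold curveDet tripleProduct
  have := e1 0; have := e1 1; have := e1 2; have := e2 0; have := e2 1; have := e2 2
  fun_prop

lemma curveDet_pos {ω : Space × ℝ} (hω : ω ∈ sumRange S₁ S₂ N) : 0 < curveDet S₁ S₂ N ω := by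
  rw [curveDet, sub_curvePoint hω, curvePoint_eq hω]
  exact h.pos _ (split_mem hω).1 _ (split_mem hω).2

/-- The curve `S₁ ∩ (x - S₂)` is differentiable with respect to the height, with speed
`sin α / det (n₁, n₂, N)`. -/
lemma hasDerivAt_curvePoint {x : Space} {t : ℝ} (ht : t ∈ heights S₁ S₂ N x) :
    HasDerivAt (fun t => curvePoint S₁ S₂ N (x, t))
      (deriv (fun t => curvePoint S₁ S₂ N (x, t)) t) t ∧
    ‖deriv (fun t => curvePoint S₁ S₂ N (x, t)) t‖ =
      curveSin S₁ S₂ N (x, t) / curveDet S₁ S₂ N (x, t) := by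
  obtain ⟨_, L, hL, hLv⟩ := h.sumRange_mem_nhds_and_hasFDerivAt_split ht
  have hsplit := split_mem ht
  have hline : HasFDerivAt (fun s : ℝ => (x, s)) (ContinuousLinearMap.inr ℝ Space ℝ) t :=
    hasFDerivAt_prodMk_right x t
  have h1 : HasFDerivAt (fun s : ℝ => S₁.param (split S₁ S₂ N (x, s)).1)
      ((S₁.tangent (split S₁ S₂ N (x, t)).1 ∘L ContinuousLinearMap.fst ℝ Plane Plane) ∘L L ∘L
        ContinuousLinearMap.inr ℝ Space ℝ) t := by
    have a := (hasStrictFDerivAt_param h.left.isOpen h.left.contDiffOn hsplit.1).hasFDerivAt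
    exact (a.comp _ hasFDerivAt_fst).comp t (hL.comp t hline)
  have h2 : HasDerivAt (fun s : ℝ => curvePoint S₁ S₂ N (x, s))
      (S₁.tangent (split S₁ S₂ N (x, t)).1 (L (0, 1)).1) t := by
    refine HasDerivAt.congr_of_eventuallyEq (f := fun s : ℝ => S₁.param (split S₁ S₂ N (x, s)).1)
      ?_ ?_
    · simpa using h1.hasDerivAt
    · filter_upwards [(h.isOpen_heights x).mem_nhds ht] with s hs
      exact curvePoint_eq hs
  rw [h2.deriv]
  refine ⟨h2, ?_⟩
  have hpos := h.curveDet_pos ht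
  rw [eq_div_iff hpos.ne', ← abs_of_pos hpos, curveDet, curveSin]
  rw [norm_mul_abs_tripleProduct (S₁.norm_normal _) (S₂.norm_normal _) hpos.ne', (hLv (0, 1)).2,
    abs_one, mul_one]
  · rw [curvePoint_eq ht, inner_normal_tangent]
  · have := (hLv (0, 1)).1
    rw [show S₁.tangent (split S₁ S₂ N (x, t)).1 (L (0, 1)).1 =
      -S₂.tangent (split S₁ S₂ N (x, t)).2 (L (0, 1)).2 from eq_neg_of_add_eq_zero_left this]
    have e := sub_curvePoint ht
    simp only at e
    rw [e, inner_neg_right, inner_normal_tangent, neg_zero]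

/-- The length measure on `S₁ ∩ (x - S₂)` in terms of the height. -/
lemma hausdorffMeasure_restrict_convCurve (x : Space) :
    (Measure.hausdorffMeasure 1).restrict (convCurve S₁ S₂ x) =
      ((volume.restrict (heights S₁ S₂ N x)).withDensity fun t => ENNReal.ofReal
        (curveSin S₁ S₂ N (x, t) / curveDet S₁ S₂ N (x, t))).map
        (fun t => curvePoint S₁ S₂ N (x, t)) := by
  have hm := (h.isOpen_heights x).measurableSet
  rw [← h.image_curvePoint, hausdorffMeasure_restrict_curve hm
    (fun t ht => (h.hasDerivAt_curvePoint ht).1.hasDerivWithinAt) (measurable_deriv _)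
    (h.measurable_curvePoint.comp measurable_prodMk_left) (injOn_curvePoint x)]
  congr 1
  refine withDensity_congr_ae ?_
  filter_upwards [ae_restrict_mem hm] with t ht
  rw [← (h.hasDerivAt_curvePoint ht).2, ofReal_norm]

end TransversePair

end RotatedGraph

/-! ### The change of variables on triples of points -/

namespace RotatedGraph

open Set

/-- For `x ∈ S₃` and two points `y`, `y'` of the curve `S₁ ∩ (x - S₂)`, given by their heights,
the parameters of the points `y ∈ S₁` and `x - y' ∈ S₂`. -/
noncomputable def crossMap (S₁ S₂ S₃ : RotatedGraph) (N : Space) (w : Plane × Plane) :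
    Plane × Plane :=
  ((split S₁ S₂ N (S₃.param w.1, w.2 0)).1, (split S₁ S₂ N (S₃.param w.1, w.2 1)).2)

/-- The domain of `crossMap`. -/
def crossDomain (S₁ S₂ S₃ : RotatedGraph) (N : Space) : Set (Plane × Plane) :=
  {w | w.1 ∈ S₃.U ∧ (S₃.param w.1, w.2 0) ∈ sumRange S₁ S₂ N ∧
    (S₃.param w.1, w.2 1) ∈ sumRange S₁ S₂ N}

/-- Three surfaces of class `C¹` such that the determinant of the normals at any three of their
points is at least `δ > 0`. -/
structure TransverseTriple (S₁ S₂ S₃ : RotatedGraph) (δ : ℝ) : Prop where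
  fst : S₁.IsRegular
  snd : S₂.IsRegular
  trd : S₃.IsRegular
  pos : 0 < δ
  le : ∀ p ∈ S₁.U, ∀ q ∈ S₂.U, ∀ r ∈ S₃.U,
    δ ≤ tripleProduct (S₁.normal (S₁.param p)) (S₂.normal (S₂.param q)) (S₃.normal (S₃.param r))

variable {S₁ S₂ S₃ : RotatedGraph} {N : Space} {δ : ℝ}

lemma TransverseTriple.pair (h : TransverseTriple S₁ S₂ S₃ δ) {r : Plane} (hr : r ∈ S₃.U) :
    TransversePair S₁ S₂ (S₃.normal (S₃.param r)) where
  left := h.fst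
  right := h.snd
  pos p hp q hq := h.pos.trans_le (h.le p hp q hq r hr)

lemma param_split_add {x : Space} {t : ℝ} (ht : (x, t) ∈ sumRange S₁ S₂ N) :
    S₁.param (split S₁ S₂ N (x, t)).1 + S₂.param (split S₁ S₂ N (x, t)).2 = x :=
  congrArg Prod.fst (sumHeight_split ht)

lemma inner_param_split {x : Space} {t : ℝ} (ht : (x, t) ∈ sumRange S₁ S₂ N) :
    inner ℝ N (S₁.param (split S₁ S₂ N (x, t)).1) = t :=
  congrArg Prod.snd (sumHeight_split ht)

/-- If `(x, y, y')` and `(u, v, v')` have the same image, then `x - u` is a chord of all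
three surfaces, which transversality excludes unless `x = u`. -/
lemma TransverseTriple.injOn_crossMap (h : TransverseTriple S₁ S₂ S₃ δ) :
    InjOn (crossMap S₁ S₂ S₃ N) (crossDomain S₁ S₂ S₃ N) := by
  rintro ⟨p, s⟩ ⟨hp, hs0, hs1⟩ ⟨p', s'⟩ ⟨hp', hs0', hs1'⟩ heq
  simp only [crossMap, Prod.mk.injEq] at heq hp hs0 hs1 hp' hs0' hs1'
  obtain ⟨e1, e2⟩ := heq
  have a0 := param_split_add hs0
  have a1 := param_split_add hs1
  have b0 := param_split_add hs0'
  have b1 := param_split_add hs1'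
  rw [← e1] at b0
  rw [← e2] at b1
  obtain ⟨r₁, hr₁, h₁⟩ := exists_inner_normal_sub_eq_zero h.fst.isOpen h.fst.convex
    h.fst.contDiffOn (split_mem hs1').1 (split_mem hs1).1
  obtain ⟨r₂, hr₂, h₂⟩ := exists_inner_normal_sub_eq_zero h.snd.isOpen h.snd.convex
    h.snd.contDiffOn (split_mem hs0').2 (split_mem hs0).2
  obtain ⟨r₃, hr₃, h₃⟩ := exists_inner_normal_sub_eq_zero h.trd.isOpen h.trd.convex
    h.trd.contDiffOn hp' hp
  rw [eq_sub_of_add_eq a1, eq_sub_of_add_eq b1, sub_sub_sub_cancel_right] at h₁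
  rw [eq_sub_of_add_eq' a0, eq_sub_of_add_eq' b0, sub_sub_sub_cancel_right] at h₂
  have hx := sub_eq_zero.1 (eq_zero_of_tripleProduct_ne_zero
    (h.pos.trans_le (h.le r₁ hr₁ r₂ hr₂ r₃ hr₃)).ne' h₁ h₂ h₃)
  refine Prod.ext (S₃.param_injective hx) ?_
  ext i
  fin_cases i
  · have := inner_param_split hs0
    rw [e1, inner_param_split hs0'] at this
    exact this.symm
  · have : inner ℝ N (S₁.param (split S₁ S₂ N (S₃.param p, s 1)).1) =
        inner ℝ N (S₁.param (split S₁ S₂ N (S₃.param p', s' 1)).1) := by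
      rw [eq_sub_of_add_eq a1, eq_sub_of_add_eq b1, hx]
    rw [inner_param_split hs1, inner_param_split hs1'] at this
    exact this

lemma TransversePair.isOpen_crossDomain (h : TransversePair S₁ S₂ N) (h₃ : S₃.IsRegular) :
    IsOpen (crossDomain S₁ S₂ S₃ N) := by
  have hU : IsOpen {w : Plane × Plane | w.1 ∈ S₃.U} := h₃.isOpen.preimage continuous_fst
  have hc : ContinuousOn (fun w : Plane × Plane => S₃.param w.1) {w | w.1 ∈ S₃.U} :=
    (continuousOn_param h₃.isOpen h₃.contDiffOn).comp continuousOn_fst fun _ hw => hw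
  have hc' : ∀ i : Fin 2, ContinuousOn (fun w : Plane × Plane => (S₃.param w.1, w.2 i))
      {w | w.1 ∈ S₃.U} := fun i => hc.prodMk (by fun_prop)
  have := ((hc' 0).isOpen_inter_preimage hU h.isOpen_sumRange).inter
    ((hc' 1).isOpen_inter_preimage hU h.isOpen_sumRange)
  convert this using 1
  ext w
  simp only [crossDomain, mem_ofPred_eq, mem_inter_iff, mem_preimage]
  tauto

/-- The area spanned by two tangent vectors, in terms of their inner products with two vectors
which complete the normal to a basis. -/
lemma abs_wedge_mul {S : RotatedGraph} {p q r : Plane} {b c : Space} {γ : ℝ}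
    (hq : inner ℝ (S.tangent p q) b = 0) (hr : |inner ℝ (S.tangent p r) b| = 1)
    (hqc : inner ℝ (S.tangent p q) c = γ) (hγ : |γ| = 1) :
    |wedge q r| * (S.weight p * |tripleProduct (S.normal (S.param p)) b c|) = 1 := by
  have h1 := S.abs_tripleProduct_tangent p q r (S.normal (S.param p))
  have hn : inner ℝ (S.normal (S.param p)) (S.normal (S.param p)) = (1 : ℝ) := by
    rw [real_inner_self_eq_norm_sq, norm_normal]; norm_num
  have h2 := tripleProduct_mul (S.tangent p q) (S.tangent p r) (S.normal (S.param p))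
    (S.normal (S.param p)) b c
  have ho : ∀ v, inner ℝ (S.tangent p v) (S.normal (S.param p)) = 0 := fun v => by
    rw [real_inner_comm]; exact S.inner_normal_tangent p v
  rw [hq, hqc, ho, ho, hn] at h2
  have h3 := congrArg abs h2
  rw [abs_mul, h1, hn] at h3
  calc _ = _ := by simp only [abs_one]; ring
    _ = _ := h3
    _ = |inner ℝ (S.tangent p r) b| * |γ| := by
      rw [← abs_mul, ← abs_neg (_ * γ)]; congr 1; ring
    _ = 1 := by rw [hr, hγ, one_mul]

/-- The Jacobian determinant of `crossMap`: its absolute value is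
`w₃ det (n₁(y'), n₂(x - y), n₃(x)) / (w₁ D w₂ D')`, with the densities `wᵢ` of the surface measures
and the determinants `D`, `D'` of `curveDet` at `y` and `y'`. It is bounded from
below by the assumption on `δ`. The determinant is computed on a basis of the tangent space whose
vectors move either only `y` or only `x - y'`. -/
lemma TransverseTriple.hasFDerivAt_crossMap (h : TransverseTriple S₁ S₂ S₃ δ)
    (hN : TransversePair S₁ S₂ N) {w : Plane × Plane} (hw : w ∈ crossDomain S₁ S₂ S₃ N) :
    ∃ L : Plane × Plane →L[ℝ] Plane × Plane, HasFDerivAt (crossMap S₁ S₂ S₃ N) L w ∧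
      |L.det| * (S₁.weight (crossMap S₁ S₂ S₃ N w).1 * curveDet S₁ S₂ N (S₃.param w.1, w.2 0) *
        (S₂.weight (crossMap S₁ S₂ S₃ N w).2 * curveDet S₁ S₂ N (S₃.param w.1, w.2 1))) ≥
        δ * S₃.weight w.1 := by
  obtain ⟨p, s⟩ := w
  obtain ⟨hp, hs0, hs1⟩ := hw
  simp only at hp hs0 hs1 ⊢
  obtain ⟨-, L0, hL0, hL0v⟩ := hN.sumRange_mem_nhds_and_hasFDerivAt_split hs0
  obtain ⟨-, L1, hL1, hL1v⟩ := hN.sumRange_mem_nhds_and_hasFDerivAt_split hs1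
  have m0 := split_mem hs0
  have m1 := split_mem hs1
  have hD0 := hN.curveDet_pos hs0
  have hD1 := hN.curveDet_pos hs1
  have d0 : curveDet S₁ S₂ N (S₃.param p, s 0) = tripleProduct
      (S₁.normal (S₁.param (split S₁ S₂ N (S₃.param p, s 0)).1))
      (S₂.normal (S₂.param (split S₁ S₂ N (S₃.param p, s 0)).2)) N := by
    rw [curveDet, sub_curvePoint hs0, curvePoint_eq hs0]
  have d1 : curveDet S₁ S₂ N (S₃.param p, s 1) = tripleProduct
      (S₁.normal (S₁.param (split S₁ S₂ N (S₃.param p, s 1)).1))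
      (S₂.normal (S₂.param (split S₁ S₂ N (S₃.param p, s 1)).2)) N := by
    rw [curveDet, sub_curvePoint hs1, curvePoint_eq hs1]
  have hΔ := h.le _ m1.1 _ m0.2 p hp
  rw [d0] at hD0 ⊢
  rw [d1] at hD1 ⊢
  have cr : crossMap S₁ S₂ S₃ N (p, s) = ((split S₁ S₂ N (S₃.param p, s 0)).1,
    (split S₁ S₂ N (S₃.param p, s 1)).2) := rfl
  rw [cr]
  simp only
  -- the derivative
  have hp3 : HasFDerivAt (fun w : Plane × Plane => S₃.param w.1)
      (S₃.tangent p ∘L ContinuousLinearMap.fst ℝ Plane Plane) (p, s) :=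
    (hasStrictFDerivAt_param h.trd.isOpen h.trd.contDiffOn hp).hasFDerivAt.comp (p, s)
      (f := Prod.fst) hasFDerivAt_fst
  have hcoord : ∀ i : Fin 2, HasFDerivAt (fun w : Plane × Plane => w.2 i)
      (EuclideanSpace.proj i ∘L ContinuousLinearMap.snd ℝ Plane Plane) (p, s) := fun i =>
    ((EuclideanSpace.proj (𝕜 := ℝ) i).hasFDerivAt).comp (p, s) (f := Prod.snd) hasFDerivAt_snd
  have hbase : ∀ i : Fin 2, HasFDerivAt (fun w : Plane × Plane => (S₃.param w.1, w.2 i))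
      ((S₃.tangent p ∘L ContinuousLinearMap.fst ℝ Plane Plane).prod
        (EuclideanSpace.proj i ∘L ContinuousLinearMap.snd ℝ Plane Plane)) (p, s) := fun i =>
    hp3.prodMk (hcoord i)
  have hT := (HasFDerivAt.comp (g := Prod.fst) (p, s) hasFDerivAt_fst
    (hL0.comp (p, s) (hbase 0))).prodMk
    (HasFDerivAt.comp (g := Prod.snd) (p, s) hasFDerivAt_snd (hL1.comp (p, s) (hbase 1)))
  refine ⟨_, hT, ?_⟩
  set L := (ContinuousLinearMap.fst ℝ Plane Plane ∘L L0 ∘L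
    ((S₃.tangent p ∘L ContinuousLinearMap.fst ℝ Plane Plane).prod
        (EuclideanSpace.proj 0 ∘L ContinuousLinearMap.snd ℝ Plane Plane))).prod
    (ContinuousLinearMap.snd ℝ Plane Plane ∘L L1 ∘L
    ((S₃.tangent p ∘L ContinuousLinearMap.fst ℝ Plane Plane).prod
        (EuclideanSpace.proj 1 ∘L ContinuousLinearMap.snd ℝ Plane Plane)))
  have hLv : ∀ v, L v = ((L0 (S₃.tangent p v.1, v.2 0)).1, (L1 (S₃.tangent p v.1, v.2 1)).2) :=
    fun v => rfl
  clear_value L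
  clear hT hbase hL0 hL1 hs0 hs1 d0 d1 cr
  set p₀ := (split S₁ S₂ N (S₃.param p, s 0)).1
  set q₀ := (split S₁ S₂ N (S₃.param p, s 0)).2
  set p₁ := (split S₁ S₂ N (S₃.param p, s 1)).1
  set q₁ := (split S₁ S₂ N (S₃.param p, s 1)).2
  -- the basis of the tangent plane of `S₃` dual to the normals of `S₁` and `S₂`
  obtain ⟨u, hu1, hu2, hu3⟩ := exists_inner_eq (h.pos.trans_le hΔ).ne' 1 0 0
  obtain ⟨v, hv1, hv2, hv3⟩ := exists_inner_eq (h.pos.trans_le hΔ).ne' 0 1 0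
  obtain ⟨a, ha⟩ := S₃.exists_tangent_eq hu3
  obtain ⟨b, hb⟩ := S₃.exists_tangent_eq hv3
  -- moving `x` along `u` keeps `y` fixed, and moving `x` and `y'` along `v` keeps `x - y'` fixed
  have z0 : L0 (0, 0) = 0 := map_zero L0
  have z1 : L1 (0, 0) = 0 := map_zero L1
  have k1 : L (0, !₂[1, 0]) = ((L0 (0, 1)).1, 0) := by
    rw [hLv]; simp [z1]
  have k2 : L (0, !₂[0, 1]) = (0, (L1 (0, 1)).2) := by
    rw [hLv]; simp [z0]
  have k3 : L (a, 0) = (0, (L1 (u, 0)).2) := by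
    obtain ⟨c1, c2⟩ := hL0v (u, 0)
    have : S₁.tangent p₀ (L0 (u, 0)).1 = 0 := by
      refine eq_zero_of_tripleProduct_ne_zero hD0.ne' (S₁.inner_normal_tangent _ _) ?_ c2
      rw [eq_sub_of_add_eq c1, inner_sub_right, hu2, inner_normal_tangent, sub_zero]
    have h0 := S₁.tangent_injective p₀ (this.trans (map_zero _).symm)
    rw [hLv]; simp [ha, h0]
  have k4 : L (b, !₂[0, inner ℝ N v]) = ((L0 (v, 0)).1, 0) := by
    obtain ⟨c1, c2⟩ := hL1v (v, inner ℝ N v)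
    have : S₂.tangent q₁ (L1 (v, inner ℝ N v)).2 = 0 := by
      refine eq_zero_of_tripleProduct_ne_zero hD1.ne' ?_ (S₂.inner_normal_tangent _ _) ?_
      · rw [eq_sub_of_add_eq' c1, inner_sub_right, hv1, inner_normal_tangent, sub_zero]
      · rw [eq_sub_of_add_eq' c1, inner_sub_right, c2, sub_self]
    have h0 := S₂.tangent_injective q₁ (this.trans (map_zero _).symm)
    rw [hLv]; simp [hb, h0]
  have hdet := abs_det_mul_wedge (L : Plane × Plane →ₗ[ℝ] Plane × Plane) k1 k2 k3 k4
  have w3 : |wedge a b| * (S₃.weight p * |tripleProduct (S₃.normal (S₃.param p))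
      (S₂.normal (S₂.param q₀)) (S₁.normal (S₁.param p₁))|) = 1 := by
    apply abs_wedge_mul (γ := 1)
    · rw [ha, real_inner_comm]; exact hu2
    · rw [hb, real_inner_comm, hv2, abs_one]
    · rw [ha, real_inner_comm]; exact hu1
    · exact abs_one
  have w1 : |wedge (L0 (0, 1)).1 (L0 (v, 0)).1| * (S₁.weight p₀ * |tripleProduct
      (S₁.normal (S₁.param p₀)) (S₂.normal (S₂.param q₀)) N|) = 1 := by
    obtain ⟨c1, c2⟩ := hL0v (0, 1)
    obtain ⟨c3, c4⟩ := hL0v (v, 0)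
    apply abs_wedge_mul (γ := 1)
    · rw [real_inner_comm, eq_neg_of_add_eq_zero_left c1, inner_neg_right, inner_normal_tangent,
        neg_zero]
    · rw [real_inner_comm, eq_sub_of_add_eq c3, inner_sub_right, inner_normal_tangent, sub_zero,
        hv2, abs_one]
    · rw [real_inner_comm]; exact c2
    · exact abs_one
  have w2 : |wedge (L1 (0, 1)).2 (L1 (u, 0)).2| * (S₂.weight q₁ * |tripleProduct
      (S₂.normal (S₂.param q₁)) (S₁.normal (S₁.param p₁)) N|) = 1 := by
    obtain ⟨c1, c2⟩ := hL1v (0, 1)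
    obtain ⟨c3, c4⟩ := hL1v (u, 0)
    apply abs_wedge_mul (γ := -1)
    · rw [real_inner_comm, eq_neg_of_add_eq_zero_right c1, inner_neg_right, inner_normal_tangent,
        neg_zero]
    · rw [real_inner_comm, eq_sub_of_add_eq' c3, inner_sub_right, inner_normal_tangent, sub_zero,
        hu1, abs_one]
    · rw [real_inner_comm, eq_neg_of_add_eq_zero_right c1, inner_neg_right, c2]
    · simp
  have swap : ∀ x y z : Space, |tripleProduct x y z| = |tripleProduct y x z| := by
    intro x y z
    rw [← abs_neg]; congr 1; simp only [tripleProduct]; ring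
  have rev : ∀ x y z : Space, |tripleProduct x y z| = |tripleProduct z y x| := by
    intro x y z
    rw [← abs_neg]; congr 1; simp only [tripleProduct]; ring
  rw [rev, abs_of_pos (h.pos.trans_le hΔ)] at w3
  rw [abs_of_pos hD0] at w1
  rw [swap, abs_of_pos hD1] at w2
  rw [ge_iff_le]
  set Δ := tripleProduct (S₁.normal (S₁.param p₁)) (S₂.normal (S₂.param q₀))
    (S₃.normal (S₃.param p))
  have hgoal : |L.det| * (S₁.weight p₀ * tripleProduct (S₁.normal (S₁.param p₀))
      (S₂.normal (S₂.param q₀)) N * (S₂.weight q₁ * tripleProduct (S₁.normal (S₁.param p₁))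
      (S₂.normal (S₂.param q₁)) N)) = S₃.weight p * Δ := by
    calc _ = |L.det| * (|wedge a b| * (S₃.weight p * Δ)) * (S₁.weight p₀ * tripleProduct
          (S₁.normal (S₁.param p₀)) (S₂.normal (S₂.param q₀)) N * (S₂.weight q₁ * tripleProduct
          (S₁.normal (S₁.param p₁)) (S₂.normal (S₂.param q₁)) N)) := by rw [w3, mul_one]
      _ = (|L.det| * |wedge a b|) * (S₃.weight p * Δ) * (S₁.weight p₀ * tripleProduct
          (S₁.normal (S₁.param p₀)) (S₂.normal (S₂.param q₀)) N * (S₂.weight q₁ * tripleProduct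
          (S₁.normal (S₁.param p₁)) (S₂.normal (S₂.param q₁)) N)) := by ring
      _ = (|wedge (L0 (0, 1)).1 (L0 (v, 0)).1| * (S₁.weight p₀ * tripleProduct
          (S₁.normal (S₁.param p₀)) (S₂.normal (S₂.param q₀)) N)) *
          (|wedge (L1 (0, 1)).2 (L1 (u, 0)).2| * (S₂.weight q₁ * tripleProduct
          (S₁.normal (S₁.param p₁)) (S₂.normal (S₂.param q₁)) N)) * (S₃.weight p * Δ) := by
        rw [show |L.det| * |wedge a b| = _ from hdet]; ring
      _ = _ := by rw [w1, w2]; ring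
  rw [hgoal, mul_comm]
  exact mul_le_mul_of_nonneg_left hΔ (S₃.weight_pos p).le

end RotatedGraph

/-! ### Integration over the curves and the surfaces -/

namespace RotatedGraph

open Set

variable {S₁ S₂ S₃ : RotatedGraph} {N : Space} {δ : ℝ}

lemma IsRegular.aemeasurable_param {S : RotatedGraph} (h : S.IsRegular) :
    AEMeasurable S.param (volume.restrict S.U) :=
  (continuousOn_param h.isOpen h.contDiffOn).aemeasurable h.isOpen.measurableSet

lemma IsRegular.lintegral_surfaceMeasure {S : RotatedGraph} (h : S.IsRegular) {a : Space → ℝ≥0∞}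
    (ha : Measurable a) : ∫⁻ x, a x ∂S.surfaceMeasure =
      ∫⁻ p in S.U, a (S.param p) * ENNReal.ofReal (S.weight p) := by
  have hm := h.aemeasurable_param
  have hw : Measurable fun p => ENNReal.ofReal (S.weight p) := S.measurable_weight.ennreal_ofReal
  change ∫⁻ x, a x ∂(((volume.restrict S.U).withDensity fun p =>
    ENNReal.ofReal (S.weight p)).map S.param) = _
  rw [lintegral_map' ha.aemeasurable (hm.mono_ac (withDensity_absolutelyContinuous _ _)),
    lintegral_withDensity_eq_lintegral_mul₀ (g := fun p => a (S.param p)) hw.aemeasurable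
      (ha.comp_aemeasurable hm)]
  simp only [Pi.mul_apply, mul_comm]

/-- The integral of `a` over the curve `S₁ ∩ (x - S₂)`, weighted with `1 / sin α`, as an integral
over the heights of the points. -/
noncomputable def heightIntegral (S₁ S₂ : RotatedGraph) (N : Space) (a : Space × ℝ → ℝ≥0∞)
    (x : Space) : ℝ≥0∞ :=
  ∫⁻ t in heights S₁ S₂ N x, a (x, t) * ENNReal.ofReal (curveDet S₁ S₂ N (x, t))⁻¹

/-- The integrand of `heightIntegral` as a function on the whole line. -/
noncomputable def heightDensity (S₁ S₂ : RotatedGraph) (N : Space) (a : Space × ℝ → ℝ≥0∞) :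
    Space × ℝ → ℝ≥0∞ :=
  (sumRange S₁ S₂ N).indicator fun ω => a ω * ENNReal.ofReal (curveDet S₁ S₂ N ω)⁻¹

lemma TransversePair.measurable_heightDensity (h : TransversePair S₁ S₂ N)
    {a : Space × ℝ → ℝ≥0∞} (ha : Measurable a) : Measurable (heightDensity S₁ S₂ N a) :=
  (ha.mul h.measurable_curveDet.inv.ennreal_ofReal).indicator h.isOpen_sumRange.measurableSet

lemma TransversePair.heightIntegral_eq (h : TransversePair S₁ S₂ N) (a : Space × ℝ → ℝ≥0∞)
    (x : Space) : heightIntegral S₁ S₂ N a x = ∫⁻ t, heightDensity S₁ S₂ N a (x, t) := by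
  rw [heightIntegral, ← lintegral_indicator (h.isOpen_heights x).measurableSet]
  rfl

lemma TransversePair.measurable_heightIntegral (h : TransversePair S₁ S₂ N)
    {a : Space × ℝ → ℝ≥0∞} (ha : Measurable a) : Measurable (heightIntegral S₁ S₂ N a) := by
  simp_rw [funext (h.heightIntegral_eq a)]
  exact (h.measurable_heightDensity ha).lintegral_prod_right'

lemma lintegral_plane_mul {a b : ℝ → ℝ≥0∞} (ha : Measurable a) (hb : Measurable b) :
    ∫⁻ s : Plane, a (s 0) * b (s 1) = (∫⁻ t, a t) * ∫⁻ t, b t := by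
  have h1 := (volume_preserving_finTwoArrow ℝ).comp (PiLp.volume_preserving_ofLp (Fin 2))
  rw [← lintegral_prod_mul ha.aemeasurable hb.aemeasurable]
  exact h1.lintegral_comp (f := fun z : ℝ × ℝ => a z.1 * b z.2) (by fun_prop)

/-- The integral over `x ∈ S₃` of a product of integrals over `S₁ ∩ (x - S₂)` is an integral over
the triples `(x, y, y')`. -/
lemma TransversePair.lintegral_heightIntegral_mul (h : TransversePair S₁ S₂ N)
    (h₃ : S₃.IsRegular) {a b : Space × ℝ → ℝ≥0∞} (ha : Measurable a) (hb : Measurable b) :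
    ∫⁻ x, heightIntegral S₁ S₂ N a x * heightIntegral S₁ S₂ N b x ∂S₃.surfaceMeasure =
      ∫⁻ w in crossDomain S₁ S₂ S₃ N, ENNReal.ofReal (S₃.weight w.1) *
        ((a (S₃.param w.1, w.2 0) *
            ENNReal.ofReal (curveDet S₁ S₂ N (S₃.param w.1, w.2 0))⁻¹) *
          (b (S₃.param w.1, w.2 1) *
            ENNReal.ofReal (curveDet S₁ S₂ N (S₃.param w.1, w.2 1))⁻¹)) := by
  classical
  have ma := h.measurable_heightDensity ha
  have mb := h.measurable_heightDensity hb
  have hU := h₃.isOpen.measurableSet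
  rw [h₃.lintegral_surfaceMeasure
    (a := fun x => heightIntegral S₁ S₂ N a x * heightIntegral S₁ S₂ N b x)
    ((h.measurable_heightIntegral ha).mul (h.measurable_heightIntegral hb))]
  -- replace the parametrization, which is not measurable off `U`, by a measurable function
  let π : Plane → Space := S₃.U.piecewise S₃.param 0
  have hπ : Measurable π :=
    (continuousOn_param h₃.isOpen h₃.contDiffOn).measurable_piecewise continuousOn_const hU
  have hπe : ∀ p ∈ S₃.U, π p = S₃.param p := fun p hp => piecewise_eq_of_mem _ _ _ hp
  let H : Plane × Plane → ℝ≥0∞ := fun w =>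
    S₃.U.indicator (fun p => ENNReal.ofReal (S₃.weight p)) w.1 *
      (heightDensity S₁ S₂ N a (π w.1, w.2 0) * heightDensity S₁ S₂ N b (π w.1, w.2 1))
  have hcoord : ∀ i : Fin 2, Measurable fun w : Plane × Plane => (π w.1, w.2 i) := fun i =>
    (hπ.comp measurable_fst).prodMk
      ((EuclideanSpace.proj (𝕜 := ℝ) i).measurable.comp measurable_snd)
  have hH : Measurable H :=
    ((S₃.measurable_weight.ennreal_ofReal.indicator hU).comp measurable_fst).mul
      ((ma.comp (hcoord 0)).mul (mb.comp (hcoord 1)))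
  have e1 : ∫⁻ p in S₃.U, heightIntegral S₁ S₂ N a (S₃.param p) *
      heightIntegral S₁ S₂ N b (S₃.param p) * ENNReal.ofReal (S₃.weight p) =
      ∫⁻ p, ∫⁻ s, H (p, s) := by
    rw [← lintegral_indicator hU]
    refine lintegral_congr fun p => ?_
    by_cases hp : p ∈ S₃.U
    · rw [indicator_of_mem hp, h.heightIntegral_eq, h.heightIntegral_eq, mul_comm]
      simp only [H, indicator_of_mem hp, hπe p hp]
      rw [lintegral_const_mul' _ _ ENNReal.ofReal_ne_top,
        lintegral_plane_mul (a := fun t => heightDensity S₁ S₂ N a (S₃.param p, t))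
          (b := fun t => heightDensity S₁ S₂ N b (S₃.param p, t))
          (ma.comp measurable_prodMk_left) (mb.comp measurable_prodMk_left)]
    · simp [H, indicator_of_notMem hp]
  have e2 : ∫⁻ p, ∫⁻ s, H (p, s) = ∫⁻ w, H w := (lintegral_prod _ hH.aemeasurable).symm
  refine (e1.trans e2).trans ?_
  rw [← lintegral_indicator (h.isOpen_crossDomain h₃).measurableSet]
  refine lintegral_congr fun w => ?_
  by_cases hw : w ∈ crossDomain S₁ S₂ S₃ N
  · rw [indicator_of_mem hw]
    simp only [H, heightDensity]
    rw [hπe _ hw.1, indicator_of_mem hw.1, indicator_of_mem hw.2.1, indicator_of_mem hw.2.2]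
  · rw [indicator_of_notMem hw]
    by_cases hp : w.1 ∈ S₃.U
    · simp only [H, heightDensity, hπe _ hp]
      by_cases h1 : (S₃.param w.1, w.2 0) ∈ sumRange S₁ S₂ N
      · have h2 : (S₃.param w.1, w.2 1) ∉ sumRange S₁ S₂ N := fun h2 => hw ⟨hp, h1, h2⟩
        rw [indicator_of_notMem h2, mul_zero, mul_zero]
      · rw [indicator_of_notMem h1, zero_mul, mul_zero]
    · simp [H, indicator_of_notMem hp]

/-- The core of the estimate: the change of variables `(x, y, y') ↦ (y, x - y')` with `x ∈ S₃` and
`y`, `y'` in the curve `S₁ ∩ (x - S₂)`. -/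
lemma TransverseTriple.lintegral_heightIntegral_mul_le (h : TransverseTriple S₁ S₂ S₃ δ)
    (hN : TransversePair S₁ S₂ N) {a b : Space → ℝ≥0∞} (ha : Measurable a) (hb : Measurable b) :
    ∫⁻ x, heightIntegral S₁ S₂ N (fun ω => a (curvePoint S₁ S₂ N ω)) x *
        heightIntegral S₁ S₂ N (fun ω => b (ω.1 - curvePoint S₁ S₂ N ω)) x ∂S₃.surfaceMeasure ≤
      ENNReal.ofReal δ⁻¹ * ((∫⁻ y, a y ∂S₁.surfaceMeasure) * ∫⁻ z, b z ∂S₂.surfaceMeasure) := by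
  have mc := hN.measurable_curvePoint
  rw [hN.lintegral_heightIntegral_mul h.trd (a := fun ω => a (curvePoint S₁ S₂ N ω))
    (b := fun ω => b (ω.1 - curvePoint S₁ S₂ N ω)) (ha.comp mc) (hb.comp (measurable_fst.sub mc))]
  have hW := (hN.isOpen_crossDomain h.trd).measurableSet
  have hex : ∀ w : Plane × Plane, ∃ L : Plane × Plane →L[ℝ] Plane × Plane,
      w ∈ crossDomain S₁ S₂ S₃ N → HasFDerivAt (crossMap S₁ S₂ S₃ N) L w ∧
      |L.det| * (S₁.weight (crossMap S₁ S₂ S₃ N w).1 * curveDet S₁ S₂ N (S₃.param w.1, w.2 0) *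
        (S₂.weight (crossMap S₁ S₂ S₃ N w).2 * curveDet S₁ S₂ N (S₃.param w.1, w.2 1))) ≥
        δ * S₃.weight w.1 := fun w => by
    by_cases hw : w ∈ crossDomain S₁ S₂ S₃ N
    · obtain ⟨L, hL⟩ := h.hasFDerivAt_crossMap hN hw
      exact ⟨L, fun _ => hL⟩
    · exact ⟨0, fun h => absurd h hw⟩
  choose L hL using hex
  have : (volume : Measure (Plane × Plane)).IsAddHaarMeasure :=
    Measure.prod.instIsAddHaarMeasure _ _
  let G : Plane × Plane → ℝ≥0∞ := fun v =>
    (a (S₁.param v.1) * ENNReal.ofReal (S₁.weight v.1)) *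
      (b (S₂.param v.2) * ENNReal.ofReal (S₂.weight v.2))
  have hpt : ∀ w ∈ crossDomain S₁ S₂ S₃ N, ENNReal.ofReal (S₃.weight w.1) *
        ((a (curvePoint S₁ S₂ N (S₃.param w.1, w.2 0)) *
            ENNReal.ofReal (curveDet S₁ S₂ N (S₃.param w.1, w.2 0))⁻¹) *
          (b (S₃.param w.1 - curvePoint S₁ S₂ N (S₃.param w.1, w.2 1)) *
            ENNReal.ofReal (curveDet S₁ S₂ N (S₃.param w.1, w.2 1))⁻¹)) ≤
        ENNReal.ofReal δ⁻¹ * (ENNReal.ofReal |(L w).det| * G (crossMap S₁ S₂ S₃ N w)) := by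
    intro w hw
    have h1 := hN.curveDet_pos hw.2.1
    have h2 := hN.curveDet_pos hw.2.2
    have hdet := (hL w hw).2
    have e2 : S₃.param w.1 - curvePoint S₁ S₂ N (S₃.param w.1, w.2 1) =
      S₂.param (crossMap S₁ S₂ S₃ N w).2 := sub_curvePoint hw.2.2
    have e1 : curvePoint S₁ S₂ N (S₃.param w.1, w.2 0) =
      S₁.param (crossMap S₁ S₂ S₃ N w).1 := curvePoint_eq hw.2.1
    rw [e1, e2]
    simp only [G]
    set v := crossMap S₁ S₂ S₃ N w
    set D₁ := curveDet S₁ S₂ N (S₃.param w.1, w.2 0)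
    set D₂ := curveDet S₁ S₂ N (S₃.param w.1, w.2 1)
    have w1 := S₁.weight_pos v.1
    have w2 := S₂.weight_pos v.2
    have hreal : S₃.weight w.1 * D₁⁻¹ * D₂⁻¹ ≤
        δ⁻¹ * |(L w).det| * S₁.weight v.1 * S₂.weight v.2 := by
      rw [← div_eq_mul_inv, ← div_eq_mul_inv, div_div, div_le_iff₀ (by positivity)]
      calc S₃.weight w.1 = δ⁻¹ * (δ * S₃.weight w.1) := (inv_mul_cancel_left₀ h.pos.ne' _).symm
        _ ≤ δ⁻¹ * _ := mul_le_mul_of_nonneg_left hdet (inv_nonneg.2 h.pos.le)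
        _ = _ := by ring
    have hen := ENNReal.ofReal_le_ofReal hreal
    have w3 := S₃.weight_pos w.1
    have hδ := inv_nonneg.2 h.pos.le
    rw [ENNReal.ofReal_mul (by positivity), ENNReal.ofReal_mul (by positivity),
      ENNReal.ofReal_mul (by positivity), ENNReal.ofReal_mul (by positivity),
      ENNReal.ofReal_mul (by positivity)] at hen
    calc _ = (ENNReal.ofReal (S₃.weight w.1) * ENNReal.ofReal D₁⁻¹ * ENNReal.ofReal D₂⁻¹) *
          (a (S₁.param v.1) * b (S₂.param v.2)) := by ring
      _ ≤ _ := mul_le_mul_left hen _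
      _ = _ := by ring
  calc _ ≤ ∫⁻ w in crossDomain S₁ S₂ S₃ N, ENNReal.ofReal δ⁻¹ *
        (ENNReal.ofReal |(L w).det| * G (crossMap S₁ S₂ S₃ N w)) :=
        setLIntegral_mono' hW fun w hw => hpt w hw
    _ = ENNReal.ofReal δ⁻¹ * ∫⁻ v in crossMap S₁ S₂ S₃ N '' crossDomain S₁ S₂ S₃ N, G v := by
        rw [lintegral_const_mul' _ _ ENNReal.ofReal_ne_top,
          lintegral_image_eq_lintegral_abs_det_fderiv_mul volume hW
            (fun w hw => (hL w hw).1.hasFDerivWithinAt) h.injOn_crossMap]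
    _ ≤ ENNReal.ofReal δ⁻¹ * ∫⁻ v in S₁.U ×ˢ S₂.U, G v := by
        gcongr
        rintro _ ⟨w, hw, rfl⟩
        exact ⟨(split_mem hw.2.1).1, (split_mem hw.2.2).2⟩
    _ = _ := by
        rw [h.fst.lintegral_surfaceMeasure ha, h.snd.lintegral_surfaceMeasure hb,
          ← lintegral_prod_mul, Measure.prod_restrict]
        · rfl
        · exact (ha.comp_aemeasurable h.fst.aemeasurable_param).mul
            S₁.measurable_weight.ennreal_ofReal.aemeasurable
        · exact (hb.comp_aemeasurable h.snd.aemeasurable_param).mul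
            S₂.measurable_weight.ennreal_ofReal.aemeasurable

lemma TransversePair.heightIntegral_eq_zero_iff (h : TransversePair S₁ S₂ N)
    {a : Space × ℝ → ℝ≥0∞} (ha : Measurable a) {x : Space} :
    heightIntegral S₁ S₂ N a x = 0 ↔ ∀ᵐ t ∂volume.restrict (heights S₁ S₂ N x), a (x, t) = 0 := by
  have hT := (h.isOpen_heights x).measurableSet
  have hm : Measurable fun t =>
      a (x, t) * ENNReal.ofReal (curveDet S₁ S₂ N (x, t))⁻¹ :=
    (ha.mul h.measurable_curveDet.inv.ennreal_ofReal).comp measurable_prodMk_left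
  rw [heightIntegral, lintegral_eq_zero_iff hm]
  constructor <;> intro h0 <;> filter_upwards [h0, ae_restrict_mem hT] with t ht hmem
  · refine (mul_eq_zero.1 ht).resolve_right ?_
    rw [ENNReal.ofReal_eq_zero, not_le]
    exact inv_pos.2 (h.curveDet_pos hmem)
  · rw [ht, zero_mul]; rfl

lemma sq_lintegral_mul_le {α : Type*} [MeasurableSpace α] (μ : Measure α) {a b : α → ℝ≥0∞}
    (ha : AEMeasurable a μ) (hb : AEMeasurable b μ) :
    (∫⁻ t, a t * b t ∂μ) ^ 2 ≤ (∫⁻ t, a t ^ 2 ∂μ) * ∫⁻ t, b t ^ 2 ∂μ := by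
  have := ENNReal.lintegral_mul_le_Lp_mul_Lq μ Real.HolderConjugate.two_two ha hb
  calc _ ≤ _ := pow_le_pow_left₀ (zero_le) this 2
    _ = _ := by
      rw [mul_pow, ← ENNReal.rpow_natCast, ← ENNReal.rpow_natCast, ← ENNReal.rpow_mul,
        ← ENNReal.rpow_mul]
      norm_num

lemma TransversePair.sq_heightIntegral_mul_le (h : TransversePair S₁ S₂ N)
    {a b : Space × ℝ → ℝ≥0∞} (ha : Measurable a) (hb : Measurable b) (x : Space) :
    heightIntegral S₁ S₂ N (fun ω => a ω * b ω) x ^ 2 ≤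
      heightIntegral S₁ S₂ N (fun ω => a ω ^ 2) x *
        heightIntegral S₁ S₂ N (fun ω => b ω ^ 2) x := by
  have hd : Measurable fun t => ENNReal.ofReal (curveDet S₁ S₂ N (x, t))⁻¹ :=
    h.measurable_curveDet.inv.ennreal_ofReal.comp measurable_prodMk_left
  have ma : Measurable fun t => a (x, t) := ha.comp measurable_prodMk_left
  have mb : Measurable fun t => b (x, t) := hb.comp measurable_prodMk_left
  have key : ∀ c : Space × ℝ → ℝ≥0∞, Measurable (fun t => c (x, t)) →
      heightIntegral S₁ S₂ N c x = ∫⁻ t, c (x, t) ∂((volume.restrict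
      (heights S₁ S₂ N x)).withDensity fun t => ENNReal.ofReal (curveDet S₁ S₂ N (x, t))⁻¹) := by
    intro c hc
    rw [lintegral_withDensity_eq_lintegral_mul₀ hd.aemeasurable hc.aemeasurable, heightIntegral]
    simp only [Pi.mul_apply, mul_comm]
  rw [key _ (ma.mul mb), key _ (ma.pow_const 2), key _ (mb.pow_const 2)]
  exact sq_lintegral_mul_le _ ma.aemeasurable mb.aemeasurable

/-! ### The convolution -/

lemma measurable_sin_angle (S₁ S₂ : RotatedGraph) : Measurable fun z : Space × Space =>
    Real.sin (InnerProductGeometry.angle (S₁.normal z.2) (S₂.normal (z.1 - z.2))) := by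
  have h1 : Measurable fun z : Space × Space => S₁.normal z.2 :=
    S₁.measurable_normal.comp measurable_snd
  have h2 : Measurable fun z : Space × Space => S₂.normal (z.1 - z.2) :=
    S₂.measurable_normal.comp (measurable_fst.sub measurable_snd)
  unfold InnerProductGeometry.angle
  exact Real.measurable_sin.comp (Real.measurable_arccos.comp
    ((h1.inner h2).div (h1.norm.mul h2.norm)))

lemma measurable_convIntegrand {f g : Space → ℂ} (hf : Measurable f) (hg : Measurable g) :
    Measurable fun z : Space × Space => convIntegrand S₁ S₂ f g z.1 z.2 := by
  have h1 := Complex.measurable_ofReal.comp (measurable_sin_angle S₁ S₂)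
  exact ((hf.comp measurable_snd).mul (hg.comp (measurable_fst.sub measurable_snd))).div h1

lemma TransversePair.measurable_curveSin (h : TransversePair S₁ S₂ N) :
    Measurable (curveSin S₁ S₂ N) := by
  have := (measurable_sin_angle S₁ S₂).comp (measurable_fst.prodMk h.measurable_curvePoint)
  simp only [Function.comp_def] at this
  exact this

lemma TransversePair.lintegral_convCurve (h : TransversePair S₁ S₂ N) {k : Space → ℝ≥0∞}
    (hk : Measurable k) (x : Space) :
    ∫⁻ y in convCurve S₁ S₂ x, k y ∂(Measure.hausdorffMeasure 1) =
      ∫⁻ t in heights S₁ S₂ N x,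
        ENNReal.ofReal (curveSin S₁ S₂ N (x, t) / curveDet S₁ S₂ N (x, t)) *
          k (curvePoint S₁ S₂ N (x, t)) := by
  have hc : Measurable fun t => curvePoint S₁ S₂ N (x, t) :=
    h.measurable_curvePoint.comp measurable_prodMk_left
  have hd : Measurable fun t =>
      ENNReal.ofReal (curveSin S₁ S₂ N (x, t) / curveDet S₁ S₂ N (x, t)) :=
    (h.measurable_curveSin.div h.measurable_curveDet).ennreal_ofReal.comp measurable_prodMk_left
  rw [h.hausdorffMeasure_restrict_convCurve, lintegral_map hk hc,
    lintegral_withDensity_eq_lintegral_mul₀ (g := fun t => k (curvePoint S₁ S₂ N (x, t)))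
      hd.aemeasurable (hk.comp hc).aemeasurable]
  rfl

/-- The integral of `|f(y) g(x - y)| / sin α` over `S₁ ∩ (x - S₂)` in terms of the height. -/
lemma TransversePair.lintegral_enorm_convIntegrand (h : TransversePair S₁ S₂ N) {f g : Space → ℂ}
    (hf : Measurable f) (hg : Measurable g) (x : Space) :
    ∫⁻ y in convCurve S₁ S₂ x, ‖convIntegrand S₁ S₂ f g x y‖ₑ ∂(Measure.hausdorffMeasure 1) =
      heightIntegral S₁ S₂ N (fun ω => ‖f (curvePoint S₁ S₂ N ω)‖ₑ *
        ‖g (ω.1 - curvePoint S₁ S₂ N ω)‖ₑ) x := by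
  have hk : Measurable fun y => ‖convIntegrand S₁ S₂ f g x y‖ₑ :=
    ((measurable_convIntegrand hf hg).comp measurable_prodMk_left).enorm
  rw [h.lintegral_convCurve hk, heightIntegral]
  refine setLIntegral_congr_fun (h.isOpen_heights x).measurableSet fun t ht => ?_
  have hDp := h.curveDet_pos ht
  have hsin : 0 < curveSin S₁ S₂ N (x, t) :=
    sin_angle_pos (S₁.norm_normal _) (S₂.norm_normal _) hDp.ne'
  have hnorm : ‖convIntegrand S₁ S₂ f g x (curvePoint S₁ S₂ N (x, t))‖ₑ =
      ‖f (curvePoint S₁ S₂ N (x, t))‖ₑ * ‖g (x - curvePoint S₁ S₂ N (x, t))‖ₑ *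
        ENNReal.ofReal (curveSin S₁ S₂ N (x, t))⁻¹ := by
    rw [convIntegrand, div_eq_mul_inv, enorm_mul, enorm_mul, ← Complex.ofReal_inv]
    congr 1
    rw [← ofReal_norm, Complex.norm_real]
    exact congrArg ENNReal.ofReal (Real.norm_of_nonneg (inv_nonneg.2 hsin.le))
  simp only [hnorm]
  rw [mul_comm, mul_assoc, ← ENNReal.ofReal_mul (inv_nonneg.2 hsin.le), div_eq_mul_inv,
    inv_mul_cancel_left₀ hsin.ne']

/-- The convolution of measurable functions is measurable. -/
lemma TransversePair.stronglyMeasurable_surfaceConv (h : TransversePair S₁ S₂ N) {f g : Space → ℂ}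
    (hf : Measurable f) (hg : Measurable g) : StronglyMeasurable (surfaceConv S₁ S₂ f g) := by
  let d : Space × ℝ → ℝ≥0∞ := fun ω =>
    ENNReal.ofReal (curveSin S₁ S₂ N ω / curveDet S₁ S₂ N ω)
  let k : Space × ℝ → ℂ := fun ω => convIntegrand S₁ S₂ f g ω.1 (curvePoint S₁ S₂ N ω)
  have hd : Measurable d := (h.measurable_curveSin.div h.measurable_curveDet).ennreal_ofReal
  have hk : Measurable k := (measurable_convIntegrand hf hg).comp
    (measurable_fst.prodMk h.measurable_curvePoint)
  have heq : surfaceConv S₁ S₂ f g = fun x => ∫ t,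
      (sumRange S₁ S₂ N).indicator (fun ω => (d ω).toReal • k ω) (x, t) := by
    funext x
    have hT := (h.isOpen_heights x).measurableSet
    have hc : Measurable fun t => curvePoint S₁ S₂ N (x, t) :=
      h.measurable_curvePoint.comp measurable_prodMk_left
    have hi : Measurable fun y => convIntegrand S₁ S₂ f g x y :=
      (measurable_convIntegrand hf hg).comp measurable_prodMk_left
    have hdx : Measurable fun t => ENNReal.ofReal
        (curveSin S₁ S₂ N (x, t) / curveDet S₁ S₂ N (x, t)) := hd.comp measurable_prodMk_left
    rw [surfaceConv, h.hausdorffMeasure_restrict_convCurve, integral_map hc.aemeasurable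
      hi.aestronglyMeasurable, integral_withDensity_eq_integral_toReal_smul hdx
        (Filter.Eventually.of_forall fun _ => ENNReal.ofReal_lt_top), ← integral_indicator hT]
    rfl
  rw [heq]
  exact ((hd.ennreal_toReal.smul hk).indicator
    h.isOpen_sumRange.measurableSet).stronglyMeasurable.integral_prod_right'

/-- Null sets of `S₁` and of `S₂` are met by almost no curve `S₁ ∩ (x - S₂)` with `x ∈ S₃` in a set
of positive length. -/
lemma TransverseTriple.ae_ae_notMem (h : TransverseTriple S₁ S₂ S₃ δ)
    (hN : TransversePair S₁ S₂ N) {Z₁ Z₂ : Set Space} (hZ₁ : MeasurableSet Z₁)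
    (hZ₂ : MeasurableSet Z₂) (h₁ : S₁.surfaceMeasure Z₁ = 0) (h₂ : S₂.surfaceMeasure Z₂ = 0) :
    ∀ᵐ x ∂S₃.surfaceMeasure, ∀ᵐ y ∂(Measure.hausdorffMeasure 1).restrict (convCurve S₁ S₂ x),
      y ∉ Z₁ ∧ x - y ∉ Z₂ := by
  have mc := hN.measurable_curvePoint
  have m1 : Measurable (Z₁.indicator (fun _ => 1) : Space → ℝ≥0∞) := measurable_const.indicator hZ₁
  have m2 : Measurable (Z₂.indicator (fun _ => 1) : Space → ℝ≥0∞) := measurable_const.indicator hZ₂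
  -- the second factor may be infinite, but the first one vanishes, and `0 * ∞ = 0`
  have i1 := h.lintegral_heightIntegral_mul_le hN m1 (b := fun _ => 1) measurable_const
  have i2 := h.lintegral_heightIntegral_mul_le hN (a := fun _ => 1) measurable_const m2
  rw [lintegral_indicator hZ₁, setLIntegral_one, h₁, zero_mul, mul_zero, nonpos_iff_eq_zero,
    lintegral_eq_zero_iff (by
      exact (hN.measurable_heightIntegral (m1.comp mc)).mul
        (hN.measurable_heightIntegral measurable_const))] at i1
  rw [lintegral_indicator hZ₂, setLIntegral_one, h₂, mul_zero, mul_zero, nonpos_iff_eq_zero,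
    lintegral_eq_zero_iff (by
      exact (hN.measurable_heightIntegral measurable_const).mul
        (hN.measurable_heightIntegral (m2.comp (measurable_fst.sub mc))))] at i2
  filter_upwards [i1, i2] with x hx1 hx2
  have hc : Measurable fun t => curvePoint S₁ S₂ N (x, t) := mc.comp measurable_prodMk_left
  have hZ : MeasurableSet {y | y ∉ Z₁ ∧ x - y ∉ Z₂} :=
    hZ₁.compl.inter ((measurable_const.sub measurable_id) hZ₂.compl)
  rw [hN.hausdorffMeasure_restrict_convCurve, ae_map_iff hc.aemeasurable hZ]
  refine (withDensity_absolutelyContinuous _ _).ae_le ?_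
  simp only [Pi.zero_apply, mul_eq_zero] at hx1 hx2
  have mz1 : Measurable fun ω => Z₁.indicator (fun _ => (1 : ℝ≥0∞)) (curvePoint S₁ S₂ N ω) :=
    m1.comp mc
  have mz2 : Measurable fun ω : Space × ℝ =>
      Z₂.indicator (fun _ => (1 : ℝ≥0∞)) (ω.1 - curvePoint S₁ S₂ N ω) :=
    m2.comp (measurable_fst.sub mc)
  rw [hN.heightIntegral_eq_zero_iff mz1, hN.heightIntegral_eq_zero_iff measurable_const] at hx1
  rw [hN.heightIntegral_eq_zero_iff measurable_const, hN.heightIntegral_eq_zero_iff mz2] at hx2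
  -- if the integral of the constant `1` vanishes, the set of heights is a null set
  have hx1' : ∀ᵐ t ∂volume.restrict (heights S₁ S₂ N x), curvePoint S₁ S₂ N (x, t) ∉ Z₁ := by
    rcases hx1 with hx | hx <;> filter_upwards [hx] with t ht
    · simpa using ht
    · exact absurd ht one_ne_zero
  have hx2' : ∀ᵐ t ∂volume.restrict (heights S₁ S₂ N x), x - curvePoint S₁ S₂ N (x, t) ∉ Z₂ := by
    rcases hx2 with hx | hx <;> filter_upwards [hx] with t ht
    · exact absurd ht one_ne_zero
    · simpa using ht
  filter_upwards [hx1', hx2'] with t ht1 ht2 using ⟨ht1, ht2⟩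

/-- The estimate for measurable functions. -/
lemma TransverseTriple.lintegral_sq_convIntegrand_le (h : TransverseTriple S₁ S₂ S₃ δ)
    (hN : TransversePair S₁ S₂ N) {f g : Space → ℂ} (hf : Measurable f) (hg : Measurable g) :
    ∫⁻ x, (∫⁻ y in convCurve S₁ S₂ x, ‖convIntegrand S₁ S₂ f g x y‖ₑ
        ∂(Measure.hausdorffMeasure 1)) ^ 2 ∂S₃.surfaceMeasure ≤
      ENNReal.ofReal δ⁻¹ * ((∫⁻ y, ‖f y‖ₑ ^ 2 ∂S₁.surfaceMeasure) *
        ∫⁻ z, ‖g z‖ₑ ^ 2 ∂S₂.surfaceMeasure) := by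
  have mc := hN.measurable_curvePoint
  refine le_trans (lintegral_mono fun x => ?_)
    (h.lintegral_heightIntegral_mul_le hN (hf.enorm.pow_const 2) (hg.enorm.pow_const 2))
  rw [hN.lintegral_enorm_convIntegrand hf hg]
  exact hN.sq_heightIntegral_mul_le (hf.enorm.comp mc) (hg.enorm.comp (measurable_fst.sub mc)) x

end RotatedGraph

/-! ### The estimate for square integrable functions -/

namespace RotatedGraph

variable {S₁ S₂ S₃ : RotatedGraph} {δ : ℝ}

/-- The estimate with the constant `δ ^ (-1/2)`, where `δ` is the lower bound for the determinant of
the normals. -/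
lemma TransverseTriple.convolution_estimate (h : TransverseTriple S₁ S₂ S₃ δ)
    {f g : Space → ℂ} (hf : MemLp f 2 S₁.surfaceMeasure) (hg : MemLp g 2 S₂.surfaceMeasure) :
    (∀ᵐ x ∂S₃.surfaceMeasure, IntegrableOn (convIntegrand S₁ S₂ f g x) (convCurve S₁ S₂ x)
      (Measure.hausdorffMeasure 1)) ∧
    MemLp (surfaceConv S₁ S₂ f g) 2 S₃.surfaceMeasure ∧
    eLpNorm (surfaceConv S₁ S₂ f g) 2 S₃.surfaceMeasure ≤
      ENNReal.ofReal (Real.sqrt δ⁻¹) * eLpNorm f 2 S₁.surfaceMeasure *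
        eLpNorm g 2 S₂.surfaceMeasure := by
  rcases S₃.U.eq_empty_or_nonempty with hU | ⟨r, hr⟩
  · have : S₃.surfaceMeasure = 0 := by
      rw [surfaceMeasure, hU, Measure.restrict_empty, withDensity_zero_left, Measure.map_zero]
    rw [this]
    refine ⟨by simp, ?_, by simp⟩
    exact ⟨aestronglyMeasurable_zero_measure _, by simp⟩
  have hN := h.pair hr
  obtain ⟨f', hf'm, hff'⟩ := hf.aestronglyMeasurable
  obtain ⟨g', hg'm, hgg'⟩ := hg.aestronglyMeasurable
  have mf := hf'm.measurable
  have mg := hg'm.measurable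
  have hf2 := hf.2
  have hg2 := hg.2
  rw [eLpNorm_congr_ae hff'] at hf2 ⊢
  rw [eLpNorm_congr_ae hgg'] at hg2 ⊢
  -- on almost every curve, `f` and `g` agree almost everywhere with `f'` and `g'`
  have hae : ∀ᵐ x ∂S₃.surfaceMeasure, convIntegrand S₁ S₂ f g x
      =ᵐ[(Measure.hausdorffMeasure 1).restrict (convCurve S₁ S₂ x)]
        convIntegrand S₁ S₂ f' g' x := by
    have hZ := h.ae_ae_notMem hN
      (measurableSet_toMeasurable S₁.surfaceMeasure {x | f x ≠ f' x})
      (measurableSet_toMeasurable S₂.surfaceMeasure {x | g x ≠ g' x})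
      ((measure_toMeasurable _).trans hff') ((measure_toMeasurable _).trans hgg')
    filter_upwards [hZ] with x hx
    filter_upwards [hx] with y hy
    have e1 : f y = f' y := by
      by_contra hne
      exact hy.1 (subset_toMeasurable _ _ hne)
    have e2 : g (x - y) = g' (x - y) := by
      by_contra hne
      exact hy.2 (subset_toMeasurable _ _ hne)
    rw [convIntegrand, convIntegrand, e1, e2]
  have hconv : surfaceConv S₁ S₂ f g =ᵐ[S₃.surfaceMeasure] surfaceConv S₁ S₂ f' g' := by
    filter_upwards [hae] with x hx
    exact integral_congr_ae hx
  let K : Space → ℝ≥0∞ := fun x => ∫⁻ y in convCurve S₁ S₂ x, ‖convIntegrand S₁ S₂ f' g' x y‖ₑ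
    ∂(Measure.hausdorffMeasure 1)
  have hK : ∫⁻ x, K x ^ 2 ∂S₃.surfaceMeasure ≤ ENNReal.ofReal δ⁻¹ *
      ((∫⁻ y, ‖f' y‖ₑ ^ 2 ∂S₁.surfaceMeasure) * ∫⁻ z, ‖g' z‖ₑ ^ 2 ∂S₂.surfaceMeasure) :=
    h.lintegral_sq_convIntegrand_le hN mf mg
  have hKm : Measurable K := by
    have := hN.measurable_heightIntegral
      ((mf.enorm.comp hN.measurable_curvePoint).mul
        (mg.enorm.comp (measurable_fst.sub hN.measurable_curvePoint)))
    exact (funext fun x => hN.lintegral_enorm_convIntegrand mf mg x :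
      K = heightIntegral S₁ S₂ (S₃.normal (S₃.param r)) _) ▸ this
  have norm_sq : ∀ (k : Space → ℂ) (μ : Measure Space), eLpNorm k 2 μ =
      (∫⁻ x, ‖k x‖ₑ ^ 2 ∂μ) ^ (1 / 2 : ℝ) := by
    intro k μ
    rw [eLpNorm_eq_lintegral_rpow_enorm_toReal two_ne_zero ENNReal.ofNat_ne_top]
    simp
  have hbound : eLpNorm (surfaceConv S₁ S₂ f g) 2 S₃.surfaceMeasure ≤
      ENNReal.ofReal (Real.sqrt δ⁻¹) * eLpNorm f' 2 S₁.surfaceMeasure *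
        eLpNorm g' 2 S₂.surfaceMeasure := by
    rw [eLpNorm_congr_ae hconv, norm_sq, norm_sq, norm_sq, Real.sqrt_eq_rpow,
      ← ENNReal.ofReal_rpow_of_nonneg (inv_nonneg.2 h.pos.le) (by norm_num),
      ← ENNReal.mul_rpow_of_nonneg _ _ (by norm_num),
      ← ENNReal.mul_rpow_of_nonneg _ _ (by norm_num), mul_assoc]
    refine ENNReal.rpow_le_rpow (le_trans (lintegral_mono fun x => ?_) hK) (by norm_num)
    exact pow_le_pow_left₀ zero_le (enorm_integral_le_lintegral_enorm _) 2
  have hfin : ENNReal.ofReal (Real.sqrt δ⁻¹) * eLpNorm f' 2 S₁.surfaceMeasure *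
        eLpNorm g' 2 S₂.surfaceMeasure < ∞ :=
    ENNReal.mul_lt_top (ENNReal.mul_lt_top ENNReal.ofReal_lt_top hf2) hg2
  refine ⟨?_, ⟨?_, hbound.trans_lt hfin⟩, hbound⟩
  · have hfin' : ∫⁻ x, K x ^ 2 ∂S₃.surfaceMeasure ≠ ∞ := by
      refine ne_top_of_le_ne_top ?_ hK
      have fin : ∀ (k : Space → ℂ) (μ : Measure Space), eLpNorm k 2 μ < ∞ →
          ∫⁻ x, ‖k x‖ₑ ^ 2 ∂μ ≠ ∞ := by
        intro k μ hk htop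
        rw [norm_sq, htop, ENNReal.top_rpow_of_pos (by norm_num)] at hk
        exact lt_irrefl _ hk
      exact ENNReal.mul_ne_top ENNReal.ofReal_ne_top
        (ENNReal.mul_ne_top (fin _ _ hf2) (fin _ _ hg2))
    filter_upwards [ae_lt_top (hKm.pow_const 2) hfin', hae] with x hx hxe
    refine Integrable.congr ?_ hxe.symm
    refine ⟨((measurable_convIntegrand mf mg).comp measurable_prodMk_left).aestronglyMeasurable, ?_⟩
    exact (ENNReal.pow_lt_top_iff.1 hx).resolve_right two_ne_zero
  · exact (hN.stronglyMeasurable_surfaceConv mf mg).aestronglyMeasurable.congr hconv.symm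

end RotatedGraph

lemma tripleProduct_eq_det (M : Fin 3 → Space) :
    (Matrix.of fun r c : Fin 3 => M c r).det = tripleProduct (M 0) (M 1) (M 2) := by
  rw [Matrix.det_fin_three, tripleProduct]
  simp only [Matrix.of_apply]
  ring

lemma TransverseSurfaces.transverseTriple {S : Fin 3 → RotatedGraph} {β b A : ℝ}
    (h : TransverseSurfaces S β b A) : RotatedGraph.TransverseTriple (S 0) (S 1) (S 2) A⁻¹ where
  fst := ⟨h.isOpen 0, h.convex 0, (h.regular 0).1⟩
  snd := ⟨h.isOpen 1, h.convex 1, (h.regular 1).1⟩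
  trd := ⟨h.isOpen 2, h.convex 2, (h.regular 2).1⟩
  pos := inv_pos.2 (zero_lt_one.trans_le h.one_le_A)
  le p hp q hq r hr := by
    have := (h.transversal ![(S 0).param p, (S 1).param q, (S 2).param r] (fun i => by
      fin_cases i
      exacts [⟨p, hp, rfl⟩, ⟨q, hq, rfl⟩, ⟨r, hr, rfl⟩])).1
    rw [tripleProduct_eq_det fun c => (S c).normal (![(S 0).param p, (S 1).param q,
      (S 2).param r] c)] at this
    exact this

theorem mainTheorem4 :
    ∃ C : ℝ, 0 < C ∧
      ∀ (S : Fin 3 → RotatedGraph) (β b A : ℝ), TransverseSurfaces S β b A →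
      ∀ f g : EuclideanSpace ℝ (Fin 3) → ℂ,
        MemLp f 2 (S 0).surfaceMeasure → MemLp g 2 (S 1).surfaceMeasure →
          (∀ᵐ x ∂(S 2).surfaceMeasure,
            IntegrableOn (convIntegrand (S 0) (S 1) f g x) (convCurve (S 0) (S 1) x)
              (Measure.hausdorffMeasure 1)) ∧
          MemLp (surfaceConv (S 0) (S 1) f g) 2 (S 2).surfaceMeasure ∧
          eLpNorm (surfaceConv (S 0) (S 1) f g) 2 (S 2).surfaceMeasure ≤
            ENNReal.ofReal (C * Real.sqrt A) *
              eLpNorm f 2 (S 0).surfaceMeasure * eLpNorm g 2 (S 1).surfaceMeasure := by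
  refine ⟨1, one_pos, fun S β b A h f g hf hg => ?_⟩
  have := h.transverseTriple.convolution_estimate hf hg
  rwa [inv_inv, ← one_mul (Real.sqrt A)] at this
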